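/- Let $b\ge 2$ be an integer, $\alpha_1,\alpha_2>0$ and $\eta>1$ real. Write $\{x\}=x-\lfloor x\rfloor-\frac12$ if $x\notin\mathbb Z$ and $\{x\}=0$ if $x\in\mathbb Z$, and for $y\in\mathbb R$ let $$L_{\alpha}^{b}(x)=\sum_{i=1}^\infty \frac{\{b^i x\}}{b^{\alpha i}},\qquad L_{\alpha}^{b,y}(x)=L_\alpha^b(x-y).$$ For a locally bounded $f:\mathbb R\to\mathbb R$ let $h_f(x_0)=\sup\{\alpha\ge 0: f\in C^\alpha(x_0)\}$ be its pointwise Hölder exponent, where $f\in C^{\alpha}(x_0)$ means that there are $C,r>0$ and a polynomial $P$ of degree $<\alpha$ with $|f(x)-P(x-x_0)|\le C|x-x_0|^\alpha$ for $|x-x_0|\le r$. The bivariate multifractal spectrum of $f,g$ is $$\mathcal D_{f,g}(H_1,H_2)=\dim_H\{x\in\mathbb R: h_f(x)=H_1,\ h_g(x)=H_2\},\qquad \dim_H\emptyset=-\infty .$$ With $\|\cdot\|$ the distance to the nearest integer, let $$\Delta^b(x)=\sup\{\alpha\ge1:\ \|b^nx\|\le b^{-n(\alpha-1)}\text{ for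 infinitely many }n\}.$$ Let $(l_i)_{i\ge1}$ be a strictly increasing sequence of non-negative integers with $\lim_{i\to\infty} l_{i-1}/l_i=0$, put $N_i=l_{i+1}-\lfloor l_i\eta\rfloor-1$, and define the finite words $$\nu_i=\begin{cases}0^{\lfloor l_i\eta\rfloor-l_i}\,1\,(01)^{N_i/2}&\text{if }N_i\text{ is even},\\ 0^{\lfloor l_i\eta\rfloor-l_i}\,1\,(01)^{\lfloor N_i/2\rfloor}\,1&\text{if }N_i\text{ is odd}\end{cases}$$ (for the at most finitely many $i$ with $N_i<0$, read $N_i$ as $0$). Let $y$ be the number in $[0,1)$ whose $b$-ary expansion is $\nu_1\nu_2\nu_3\cdots$. Then, for all real $H_1,H_2$, $$\mathcal D_{L_{\alpha_1}^b,L_{\alpha_2}^{b,y}}(H_1,H_2)=\begin{cases}\min\left\{\frac{H_1}{\alpha_1},\frac{H_2}{\alpha_2}\right\}&\text{if }(H_1,H_2)\in[0,\alpha_1]\times[0,\alpha_2],\\ -\infty&\text{otherwise.}\end{cases}$$ Moreover $\Delta^b(y)=\eta$, and the spectrum is not determined by $\Delta^b(y)$: there is $y'\in\mathbb R$ with $\Delta^b(y')=\Delta^b(y)$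 such that, for all $\alpha_1,\alpha_2>0$, the functions $\mathcal D_{L_{\alpha_1}^b,L_{\alpha_2}^{b,y'}}$ and $\mathcal D_{L_{\alpha_1}^b,L_{\alpha_2}^{b,y}}$ are different. -/

import Mathlib

open Filter Topology

noncomputable section

/-- The `1`-periodic saw-tooth function: `x - ⌊x⌋ - 1/2` off the integers, `0` on the integers. -/
def sawTooth (x : ℝ) : ℝ :=
  if Int.fract x = 0 then 0 else Int.fract x - 1 / 2

/-- The translated Lévy function
`L_α^{b,y}(x) = ∑_{i ≥ 1} {b^i (x - y)} / b^(α i)` (the summation index is shifted by one). -/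
def levyTranslate (b : ℕ) (α y x : ℝ) : ℝ :=
  ∑' i : ℕ, sawTooth ((b : ℝ) ^ (i + 1) * (x - y)) / (b : ℝ) ^ (α * ((i : ℝ) + 1))

/-- The Lévy function `L_α^b(x) = ∑_{i ≥ 1} {b^i x} / b^(α i)`. -/
def levy (b : ℕ) (α x : ℝ) : ℝ :=
  ∑' i : ℕ, sawTooth ((b : ℝ) ^ (i + 1) * x) / (b : ℝ) ^ (α * ((i : ℝ) + 1))

/-- `f ∈ C^α(x₀)`: near `x₀`, `f` is within `C |x - x₀|^α` of a polynomial in `x - x₀` of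
degree `< α`. The zero polynomial counts as having degree `-∞`, so that for `α = 0` the condition
says that `f` is bounded near `x₀`. -/
def HolderAtPoint (f : ℝ → ℝ) (α x₀ : ℝ) : Prop :=
  ∃ C > 0, ∃ r > 0, ∃ P : Polynomial ℝ, (∀ k : ℕ, P.coeff k ≠ 0 → (k : ℝ) < α) ∧
    ∀ x ∈ Set.Icc (x₀ - r) (x₀ + r), |f x - P.eval (x - x₀)| ≤ C * |x - x₀| ^ α

/-- The pointwise Hölder exponent `h_f(x₀) = sup {α ≥ 0 : f ∈ C^α(x₀)}`, possibly `+∞`. -/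
def holderExponent (f : ℝ → ℝ) (x₀ : ℝ) : EReal :=
  sSup ((fun α : ℝ => (α : EReal)) '' {α : ℝ | 0 ≤ α ∧ HolderAtPoint f α x₀})

/-- The bivariate level set `E_{f,g}(H₁, H₂)`. -/
def bivariateLevelSet (f g : ℝ → ℝ) (H₁ H₂ : ℝ) : Set ℝ :=
  {x : ℝ | holderExponent f x = (H₁ : EReal) ∧ holderExponent g x = (H₂ : EReal)}

open Classical in
/-- The bivariate multifractal spectrum: the Hausdorff dimension of the level set, with the
convention that the empty set has dimension `-∞`. -/
def bivariateSpectrum (f g : ℝ → ℝ) (H₁ H₂ : ℝ) : EReal :=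
  if bivariateLevelSet f g H₁ H₂ = ∅ then ⊥
  else ((dimH (bivariateLevelSet f g H₁ H₂) : ENNReal) : EReal)

/-- The `b`-adic approximation exponent `Δ^b(x)`: the supremum of all `α ≥ 1` such that
`‖b^n x‖ ≤ b^(-n (α - 1))` for infinitely many `n`, where `‖·‖` is the distance to the nearest
integer. -/
def bAdicExponent (b : ℕ) (x : ℝ) : EReal :=
  sSup ((fun α : ℝ => (α : EReal)) '' {α : ℝ | 1 ≤ α ∧ ∃ᶠ n : ℕ in atTop,
    |(b : ℝ) ^ n * x - (round ((b : ℝ) ^ n * x) : ℝ)| ≤ 1 / (b : ℝ) ^ ((n : ℝ) * (α - 1))})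

/-- The word `0^(⌊ηp⌋ - p) 1 (01)^⌊N/2⌋`, followed by one more letter `1` if `N` is odd, where
`N = q - ⌊ηp⌋ - 1`. It has length `q - p` whenever `p ≤ ⌊ηp⌋ < q`. -/
def fillerWord (η : ℝ) (p q : ℕ) : List ℕ :=
  List.replicate (⌊(p : ℝ) * η⌋₊ - p) 0 ++ [1] ++
    (List.replicate ((q - ⌊(p : ℝ) * η⌋₊ - 1) / 2) [0, 1]).flatten ++
    (if Even (q - ⌊(p : ℝ) * η⌋₊ - 1) then [] else [1])

/-- The infinite word `θ` is the concatenation `ν₀ν₁ν₂⋯` of the finite words `ν i`: the `j`-th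
letter of `ν i` is the letter of `θ` at position `|ν₀| + ⋯ + |ν_{i-1}| + j`. -/
def IsConcatenation (ν : ℕ → List ℕ) (θ : ℕ → ℕ) : Prop :=
  ∀ (i : ℕ) (j : Fin (ν i).length),
    θ ((∑ m ∈ Finset.range i, (ν m).length) + (j : ℕ)) = (ν i).get j

end

/-! The Lévy function jumps downwards at every `b`-adic rational `k / b^n`, by at least a constant
times `b^(-α n)`. Its regularity at `x` is therefore governed by how well such rationals approximate
`x`: the exponent is `α / Δ^b(x)`, i.e. `α * invExponent b x` (`holderExponent_levy`). The level set
becomes the set of `x` for which `invExponent` takes the value `a₁ = H₁ / α₁` at `x` and `a₂ = H₂ /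
α₂` at `x - y`.

The dimension is at most `min a₁ a₂` for any `y`, since covering by small balls around `b`-adic
rationals gives `dimH_invExponent_le`, and dimension is invariant under translation. The lower bound
needs room to prescribe both exponents independently. In base `B = b^K`, choose very sparse windows
`[s, S)`, in which `x` copies alternately the digits of `0` and those of `y`, with `S / s` close to
`1 / a₁` or `1 / a₂`. Outside the windows its digits are free apart from staying away from both
models. Each kind of window produces the required approximation of its own target. It does not
affect the other exponent as long as `b^n y` stays away from the integers throughout the window:
this is `HasLongWindows`. The free positions have lower density close to `min a₁ a₂`, hence so is
the dimension (`exists_subset_dimH_ge`).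

For the given `y`, the blocks `0101...` supply such windows because `l_(i-1) / l_i` tends to `0`,
while the runs of zeros produce the exponent `η`. For the comparison point `y'`, ones are placed at
positions growing geometrically with ratio `η`. The exponent is again `η`, but long windows are
missing: if `invExponent b x = 0`, the huge near-returns of `b^n x` to the integers contain entire
zero runs of `y'`, so `x - y'` is also well approximable. Thus the level set at `(0, α₂)` is empty
for `y'`, but not for `y`. -/

noncomputable section

variable {b : ℕ}

/-! ### Distance to the nearest integer along orbits of multiplication by `b`. -/

/-- The distance from a real number to the nearest integer. -/
def distInt (t : ℝ) : ℝ := |t - (round t : ℝ)|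

lemma distInt_eq_norm (t : ℝ) : distInt t = ‖(t : UnitAddCircle)‖ :=
  (UnitAddCircle.norm_eq).symm

lemma distInt_nonneg (t : ℝ) : 0 ≤ distInt t := abs_nonneg _

lemma distInt_le_half (t : ℝ) : distInt t ≤ 1 / 2 := abs_sub_round t

lemma distInt_le_abs_sub (t : ℝ) (z : ℤ) : distInt t ≤ |t - z| := round_le t z

lemma distInt_le_abs (t : ℝ) : distInt t ≤ |t| := by
  simpa using distInt_le_abs_sub t 0

lemma distInt_add_le (s t : ℝ) : distInt (s + t) ≤ distInt s + distInt t := by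
  simp only [distInt_eq_norm]
  exact norm_add_le (s : UnitAddCircle) (t : UnitAddCircle)

lemma distInt_neg (t : ℝ) : distInt (-t) = distInt t := by
  simp only [distInt_eq_norm]
  exact norm_neg (t : UnitAddCircle)

lemma distInt_sub_le (s t : ℝ) : distInt (s - t) ≤ distInt s + distInt t := by
  rw [sub_eq_add_neg, ← distInt_neg t]
  exact distInt_add_le _ _

lemma distInt_add_int (t : ℝ) (z : ℤ) : distInt (t + z) = distInt t := by
  simp [distInt]

lemma distInt_sub_int (t : ℝ) (z : ℤ) : distInt (t - z) = distInt t := by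
  simp [distInt]

lemma distInt_nat_mul (n : ℕ) (t : ℝ) : distInt (n * t) ≤ n * distInt t := by
  simp only [distInt_eq_norm]
  have : ((n * t : ℝ) : UnitAddCircle) = n • (t : UnitAddCircle) := by
    rw [← nsmul_eq_mul]; rfl
  rw [this]
  exact norm_nsmul_le

lemma distInt_pow_mul (b j : ℕ) (t : ℝ) : distInt ((b : ℝ) ^ j * t) ≤ (b : ℝ) ^ j * distInt t := by
  exact_mod_cast distInt_nat_mul (b ^ j) t

/-- A number in `[c, 1 - c]` has distance at least `c` to the integers. -/
lemma le_distInt_of_mem {c t : ℝ} (h₀ : c ≤ t) (h₁ : t ≤ 1 - c) : c ≤ distInt t := by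
  unfold distInt
  rcases le_or_gt (round t) 0 with h | h
  · have : (round t : ℝ) ≤ 0 := by exact_mod_cast h
    exact le_trans (by linarith) (le_abs_self _)
  · have : (1 : ℝ) ≤ round t := by exact_mod_cast h
    exact le_trans (by linarith) (neg_le_abs _)

lemma distInt_abs_ge {c t : ℝ} (h₀ : c ≤ |t|) (h₁ : |t| ≤ 1 - c) : c ≤ distInt t := by
  rcases abs_cases t with ⟨h, -⟩ | ⟨h, -⟩
  · rw [h] at h₀ h₁; exact le_distInt_of_mem h₀ h₁
  · rw [h] at h₀ h₁; rw [← distInt_neg]; exact le_distInt_of_mem h₀ h₁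

/-- Moving backwards along the orbit of multiplication by `b` costs a factor `b` per step. -/
lemma distInt_orbit_ge {b : ℕ} (hb : 2 ≤ b) {n m : ℕ} (hnm : n ≤ m) (x : ℝ) :
    distInt ((b : ℝ) ^ m * x) / (b : ℝ) ^ (m - n) ≤ distInt ((b : ℝ) ^ n * x) := by
  have hb0 : (0 : ℝ) < b := by positivity
  rw [div_le_iff₀ (by positivity), mul_comm (distInt _)]
  refine le_trans (le_of_eq ?_) (distInt_pow_mul b (m - n) _)
  rw [← mul_assoc, ← pow_add, Nat.sub_add_cancel hnm]

/-! ### Well approximable points and the approximation exponent. -/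

/-- The numbers `x` with `‖b^n x‖ ≤ b^(-n (δ - 1))` for infinitely many `n`. -/
def wellApprox (b : ℕ) (δ : ℝ) : Set ℝ :=
  {x : ℝ | ∃ᶠ n : ℕ in atTop, distInt ((b : ℝ) ^ n * x) ≤ 1 / (b : ℝ) ^ ((n : ℝ) * (δ - 1))}

lemma wellApprox_antitone (hb : 2 ≤ b) : Antitone (wellApprox b) := by
  intro δ δ' h x hx
  refine Frequently.mono hx fun n hn => hn.trans ?_
  have hb1 : (1 : ℝ) ≤ b := by exact_mod_cast (by omega : 1 ≤ b)
  refine one_div_le_one_div_of_le (by positivity) ?_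
  exact Real.rpow_le_rpow_of_exponent_le hb1 (by gcongr)

lemma mem_wellApprox_one (x : ℝ) : x ∈ wellApprox b 1 := by
  refine Frequently.of_forall fun n => (distInt_le_half _).trans ?_
  norm_num

/-- A constant factor is absorbed by a smaller exponent. -/
lemma eventually_const_mul_rpow_lt (hb : 2 ≤ b) (C : ℝ) {s t : ℝ} (h : s < t) :
    ∀ᶠ n : ℕ in atTop, C * (b : ℝ) ^ (-((n : ℝ) * t)) < (b : ℝ) ^ (-((n : ℝ) * s)) := by
  have hb1 : (1 : ℝ) < b := by exact_mod_cast (by omega : 1 < b)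
  have hb0 : (0 : ℝ) < b := by linarith
  have h1 : Tendsto (fun n : ℕ => ((b : ℝ) ^ (t - s)) ^ n) atTop atTop :=
    tendsto_pow_atTop_atTop_of_one_lt (Real.one_lt_rpow hb1 (by linarith))
  filter_upwards [h1.eventually_gt_atTop C] with n hn
  have h2 : (b : ℝ) ^ (-((n : ℝ) * s)) = ((b : ℝ) ^ (t - s)) ^ n * (b : ℝ) ^ (-((n : ℝ) * t)) := by
    rw [← Real.rpow_natCast, ← Real.rpow_mul hb0.le, ← Real.rpow_add hb0]
    congr 1; ring
  rw [h2]
  exact mul_lt_mul_of_pos_right hn (Real.rpow_pos_of_pos hb0 _)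

lemma mem_wellApprox_of_frequently (hb : 2 ≤ b) {x C ρ δ : ℝ} (hδ : δ < ρ)
    (h : ∃ᶠ n : ℕ in atTop, distInt ((b : ℝ) ^ n * x) ≤ C * (b : ℝ) ^ (-((n : ℝ) * (ρ - 1)))) :
    x ∈ wellApprox b δ := by
  have hb0 : (0 : ℝ) < b := by positivity
  refine (h.and_eventually
    (eventually_const_mul_rpow_lt hb C (sub_lt_sub_right hδ 1))).mono fun n hn => ?_
  rw [one_div, ← Real.rpow_neg hb0.le]
  exact hn.1.trans hn.2.le

/-- Testing multiples of `K` suffices, which permits work in base `b^K`: from the first multiple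
above `n` the bound is carried back to `n` at a bounded cost, absorbed by the strict inequality `A <
δ`. -/
lemma notMem_wellApprox_of_forall (hb : 2 ≤ b) {x c A δ : ℝ} (hc : 0 < c) (hA : 1 ≤ A)
    (hδ : A < δ) {K : ℕ} (hK : 0 < K)
    (h : ∀ᶠ m : ℕ in atTop,
      c * (b : ℝ) ^ (-(((K * m : ℕ) : ℝ) * (A - 1))) ≤ distInt ((b : ℝ) ^ (K * m) * x)) :
    x ∉ wellApprox b δ := by
  have hb0 : (0 : ℝ) < b := by positivity
  have hb1 : (1 : ℝ) ≤ b := by exact_mod_cast (by omega : 1 ≤ b)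
  intro hx
  set C := (b : ℝ) ^ K * (b : ℝ) ^ ((K : ℝ) * (A - 1)) / c with hC
  obtain ⟨m₀, hm₀⟩ := eventually_atTop.1 h
  have hev : ∀ᶠ n : ℕ in atTop, ¬ distInt ((b : ℝ) ^ n * x) ≤
      1 / (b : ℝ) ^ ((n : ℝ) * (δ - 1)) := by
    filter_upwards [eventually_const_mul_rpow_lt hb C (sub_lt_sub_right hδ 1),
      eventually_ge_atTop (K * m₀)] with n hn hn₀
    rw [not_le, one_div, ← Real.rpow_neg hb0.le]
    set m := n / K + 1
    have h1 : n ≤ K * m := by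
      have := Nat.div_add_mod n K
      have := Nat.mod_lt n hK
      simp only [m, mul_add, mul_one]; omega
    have h2 : K * m ≤ n + K := by
      have := Nat.div_add_mod n K
      simp only [m, mul_add, mul_one]; omega
    have h3 : m₀ ≤ m := le_trans ((Nat.le_div_iff_mul_le hK).2 (by linarith)) (Nat.le_succ _)
    have h4 := hm₀ m h3
    have h5 := distInt_orbit_ge hb h1 x
    have h6 : (b : ℝ) ^ (K * m - n) ≤ (b : ℝ) ^ K := pow_le_pow_right₀ hb1 (by omega)
    have h7 : (b : ℝ) ^ (-(((n : ℝ) + K) * (A - 1))) ≤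
        (b : ℝ) ^ (-(((K * m : ℕ) : ℝ) * (A - 1))) := by
      refine Real.rpow_le_rpow_of_exponent_le hb1 ?_
      have : ((K * m : ℕ) : ℝ) ≤ n + K := by exact_mod_cast h2
      have := mul_le_mul_of_nonneg_right this (sub_nonneg.2 hA)
      linarith
    have h8 : (b : ℝ) ^ (-((n : ℝ) * (A - 1))) =
        (b : ℝ) ^ ((K : ℝ) * (A - 1)) * (b : ℝ) ^ (-(((n : ℝ) + K) * (A - 1))) := by
      rw [← Real.rpow_add hb0]; congr 1; ring
    have hE : 0 < (b : ℝ) ^ ((K : ℝ) * (A - 1)) := Real.rpow_pos_of_pos hb0 _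
    have hbK : 0 < (b : ℝ) ^ K := by positivity
    refine lt_of_lt_of_le ?_ ((div_le_div₀ (distInt_nonneg _) h4 (by positivity) h6).trans h5)
    · rw [lt_div_iff₀ hbK]
      refine lt_of_lt_of_le ?_ (mul_le_mul_of_nonneg_left h7 hc.le)
      rw [h8, hC] at hn
      have := mul_lt_mul_of_pos_left hn hc
      have e1 : c * ((b : ℝ) ^ K * (b : ℝ) ^ ((K : ℝ) * (A - 1)) / c *
          (b : ℝ) ^ (-((n : ℝ) * (δ - 1)))) =
          (b : ℝ) ^ ((K : ℝ) * (A - 1)) * ((b : ℝ) ^ (-((n : ℝ) * (δ - 1))) * (b : ℝ) ^ K) := by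
        field_simp
      rw [e1] at this
      have e2 : c * ((b : ℝ) ^ ((K : ℝ) * (A - 1)) * (b : ℝ) ^ (-(((n : ℝ) + K) * (A - 1)))) =
        (b : ℝ) ^ ((K : ℝ) * (A - 1)) * (c * (b : ℝ) ^ (-(((n : ℝ) + K) * (A - 1)))) := by ring
      rw [e2] at this
      exact lt_of_mul_lt_mul_left this hE.le
  exact hx (hev.mono fun n hn => hn)

/-- The reciprocal of the `b`-adic approximation exponent, a number in `[0, 1]`. -/
def invExponent (b : ℕ) (x : ℝ) : ℝ :=
  sInf ((fun δ : ℝ => 1 / δ) '' {δ : ℝ | 1 ≤ δ ∧ x ∈ wellApprox b δ})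

lemma invExponent_le {x δ : ℝ} (hδ : 1 ≤ δ) (hx : x ∈ wellApprox b δ) :
    invExponent b x ≤ 1 / δ := by
  refine csInf_le ⟨0, ?_⟩ ⟨δ, ⟨hδ, hx⟩, rfl⟩
  rintro _ ⟨δ', h, rfl⟩
  have := h.1
  positivity

lemma approxExponents_nonempty (x : ℝ) : {δ : ℝ | 1 ≤ δ ∧ x ∈ wellApprox b δ}.Nonempty :=
  ⟨1, le_rfl, mem_wellApprox_one x⟩

lemma invExponent_le_one (x : ℝ) : invExponent b x ≤ 1 := by
  simpa using invExponent_le le_rfl (mem_wellApprox_one (b := b) x)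

lemma le_invExponent {x κ : ℝ}
    (h : ∀ δ, 1 ≤ δ → x ∈ wellApprox b δ → κ ≤ 1 / δ) : κ ≤ invExponent b x := by
  refine le_csInf ((approxExponents_nonempty x).image _) ?_
  rintro _ ⟨δ', h', rfl⟩
  exact h _ h'.1 h'.2

lemma invExponent_nonneg (x : ℝ) : 0 ≤ invExponent b x :=
  le_invExponent fun δ hδ _ => by positivity

lemma notMem_wellApprox_of_lt {x δ : ℝ} (hδ : 1 ≤ δ) (h : 1 / δ < invExponent b x) :
    x ∉ wellApprox b δ := fun hx => absurd (invExponent_le hδ hx) (not_le.2 h)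

lemma mem_wellApprox_of_lt (hb : 2 ≤ b) {x δ : ℝ} (hδ : 1 ≤ δ) (h : invExponent b x < 1 / δ) :
    x ∈ wellApprox b δ := by
  obtain ⟨_, ⟨δ', ⟨h1, h2⟩, rfl⟩, h3⟩ := exists_lt_of_csInf_lt
    ((approxExponents_nonempty x).image _) h
  refine wellApprox_antitone hb ?_ h2
  exact (one_div_lt_one_div (by linarith) (by linarith)).1 h3 |>.le

lemma wellApprox_add_int (x δ : ℝ) (z : ℤ) : x + z ∈ wellApprox b δ ↔ x ∈ wellApprox b δ := by
  have : ∀ n : ℕ, distInt ((b : ℝ) ^ n * (x + z)) = distInt ((b : ℝ) ^ n * x) := fun n => by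
    rw [mul_add, ← distInt_add_int ((b : ℝ) ^ n * x) (b ^ n * z)]
    push_cast; rfl
  simp only [wellApprox, Set.mem_ofPred_eq, this]

lemma bAdicExponent_eq_of_wellApprox {x A : ℝ} (hA : 1 < A)
    (h₁ : ∀ δ, δ < A → x ∈ wellApprox b δ) (h₂ : ∀ δ, A < δ → x ∉ wellApprox b δ) :
    bAdicExponent b x = (A : EReal) := by
  unfold bAdicExponent
  refine IsLUB.sSup_eq ⟨?_, ?_⟩
  · rintro _ ⟨δ, ⟨-, hδ⟩, rfl⟩
    by_contra hlt
    exact h₂ δ (by simpa using hlt) hδ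
  · intro u hu
    refine le_of_forall_lt fun c hc => ?_
    obtain ⟨q, hq1, hq2⟩ := EReal.lt_iff_exists_real_btwn.1 hc
    have hq3 : q < A := by exact_mod_cast hq2
    have : ((max q 1 : ℝ) : EReal) ≤ u :=
      hu ⟨max q 1, ⟨le_max_right _ _, h₁ _ (max_lt hq3 hA)⟩, rfl⟩
    exact hq1.trans_le (le_trans (by exact_mod_cast le_max_left _ _) this)

/-! ### The saw-tooth and the jumps of the Lévy function. -/

lemma abs_sawTooth_le (s : ℝ) : |sawTooth s| ≤ 1 / 2 := by
  unfold sawTooth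
  split_ifs
  · norm_num
  · have := Int.fract_nonneg s
    have := (Int.fract_lt_one s).le
    rw [abs_le]; constructor <;> linarith

lemma sawTooth_eq_of_mem_Ioo {s : ℝ} {k : ℤ} (h₀ : (k : ℝ) < s) (h₁ : s < k + 1) :
    sawTooth s = s - k - 1 / 2 := by
  have hk : ⌊s⌋ = k := Int.floor_eq_iff.2 ⟨h₀.le, h₁⟩
  have hf : Int.fract s = s - k := by rw [Int.fract, hk]
  rw [sawTooth, hf, if_neg (sub_ne_zero.2 h₀.ne')]

/-- No integer separates `v` from `s`, so both lie on the same branch of slope one. -/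
lemma sawTooth_sub_of_lt_distInt {s v : ℝ} (h : |v - s| < distInt s) :
    sawTooth v - sawTooth s = v - s := by
  have h1 := distInt_le_abs_sub s ⌊s⌋
  have h2 := distInt_le_abs_sub s (⌊s⌋ + 1)
  have h3 := Int.floor_le s
  have h4 := Int.lt_floor_add_one s
  push_cast at h2
  rw [abs_of_nonneg (by linarith)] at h1
  rw [abs_of_nonpos (by linarith)] at h2
  have h5 := abs_lt.1 h
  have h6 := abs_nonneg (v - s)
  rw [sawTooth_eq_of_mem_Ioo (k := ⌊s⌋) (by linarith) (by linarith),
    sawTooth_eq_of_mem_Ioo (k := ⌊s⌋) (by linarith) (by linarith)]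
  ring

lemma tendsto_sawTooth_right (s : ℝ) :
    Tendsto sawTooth (𝓝[>] s) (𝓝 (Int.fract s - 1 / 2)) := by
  have h1 : Tendsto (fun v : ℝ => v - ⌊s⌋ - 1 / 2) (𝓝[>] s) (𝓝 (s - ⌊s⌋ - 1 / 2)) :=
    ((continuous_id.sub continuous_const).sub continuous_const).continuousWithinAt
  refine h1.congr' ?_
  filter_upwards [Ioo_mem_nhdsGT (Int.lt_floor_add_one s)] with v hv
  exact (sawTooth_eq_of_mem_Ioo ((Int.floor_le s).trans_lt hv.1) hv.2).symm

lemma levyTranslate_eq (b : ℕ) (α y x : ℝ) : levyTranslate b α y x = levy b α (x - y) := rfl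

lemma rpow_mul_succ (b : ℕ) (α : ℝ) (i : ℕ) :
    (b : ℝ) ^ (α * ((i : ℝ) + 1)) = ((b : ℝ) ^ α) ^ (i + 1) := by
  rw [← Real.rpow_natCast, ← Real.rpow_mul (by positivity)]
  push_cast; rfl

lemma summable_inv_rpow_mul_succ (hb : 2 ≤ b) {α : ℝ} (hα : 0 < α) :
    Summable fun i : ℕ => ((b : ℝ) ^ (α * ((i : ℝ) + 1)))⁻¹ := by
  have hb1 : (1 : ℝ) < b := by exact_mod_cast (by omega : 1 < b)
  simp only [rpow_mul_succ, ← inv_pow]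
  exact (summable_nat_add_iff 1).2 (summable_geometric_of_lt_one (by positivity)
    (inv_lt_one_of_one_lt₀ (Real.one_lt_rpow hb1 hα)))

lemma summable_div_rpow (hb : 2 ≤ b) {α : ℝ} (hα : 0 < α) {f : ℕ → ℝ} {M : ℝ}
    (hf : ∀ i, |f i| ≤ M) : Summable fun i : ℕ => f i / (b : ℝ) ^ (α * ((i : ℝ) + 1)) := by
  refine Summable.of_norm_bounded ((summable_inv_rpow_mul_succ hb hα).mul_left M) fun i => ?_
  have : 0 < (b : ℝ) ^ (α * ((i : ℝ) + 1)) := Real.rpow_pos_of_pos (by positivity) _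
  rw [Real.norm_eq_abs, abs_div, abs_of_pos this, div_eq_mul_inv]
  exact mul_le_mul_of_nonneg_right (hf i) (by positivity)

lemma abs_fract_sub_half_le (s : ℝ) : |Int.fract s - 1 / 2| ≤ 1 / 2 := by
  have := Int.fract_nonneg s
  have := (Int.fract_lt_one s).le
  rw [abs_le]; constructor <;> linarith

/-- The right limit of the Lévy function. -/
lemma tendsto_levy_right (hb : 2 ≤ b) {α : ℝ} (hα : 0 < α) (t : ℝ) :
    Tendsto (levy b α) (𝓝[>] t)
      (𝓝 (∑' i : ℕ, (Int.fract ((b : ℝ) ^ (i + 1) * t) - 1 / 2) /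
        (b : ℝ) ^ (α * ((i : ℝ) + 1)))) := by
  have hb0 : (0 : ℝ) < b := by positivity
  refine tendsto_tsum_of_dominated_convergence
    ((summable_inv_rpow_mul_succ hb hα).mul_left (1 / 2)) (fun i => ?_)
    (Eventually.of_forall fun u i => ?_)
  · refine Tendsto.div_const ((tendsto_sawTooth_right _).comp ?_) _
    refine tendsto_nhdsWithin_of_tendsto_nhds_of_eventually_within _
      ((continuous_const.mul continuous_id).continuousWithinAt) ?_
    filter_upwards [self_mem_nhdsWithin] with u hu
    exact mul_lt_mul_of_pos_left (Set.mem_Ioi.1 hu) (by positivity)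
  · have : 0 < (b : ℝ) ^ (α * ((i : ℝ) + 1)) := Real.rpow_pos_of_pos (by positivity) _
    rw [Real.norm_eq_abs, abs_div, abs_of_pos this, div_eq_mul_inv]
    exact mul_le_mul_of_nonneg_right (abs_sawTooth_le _) (by positivity)

/-- At a point `t` with `b^n t` an integer the Lévy function has a jump of size `≥ b^(-α n) / 2`. -/
lemma levy_sub_right_limit_ge (hb : 2 ≤ b) {α : ℝ} (hα : 0 < α) {t : ℝ} {n : ℕ} (hn : 1 ≤ n)
    {k : ℤ} (ht : (b : ℝ) ^ n * t = k) :
    1 / 2 / (b : ℝ) ^ (α * n) ≤ levy b α t -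
      ∑' i : ℕ, (Int.fract ((b : ℝ) ^ (i + 1) * t) - 1 / 2) / (b : ℝ) ^ (α * ((i : ℝ) + 1)) := by
  have hb0 : (0 : ℝ) < b := by positivity
  have hs1 := summable_div_rpow hb hα (fun i => abs_sawTooth_le ((b : ℝ) ^ (i + 1) * t))
  have hs2 := summable_div_rpow hb hα (fun i => abs_fract_sub_half_le ((b : ℝ) ^ (i + 1) * t))
  rw [levy, ← hs1.tsum_sub hs2]
  have key : ∀ i : ℕ, sawTooth ((b : ℝ) ^ (i + 1) * t) / (b : ℝ) ^ (α * ((i : ℝ) + 1)) -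
      (Int.fract ((b : ℝ) ^ (i + 1) * t) - 1 / 2) / (b : ℝ) ^ (α * ((i : ℝ) + 1)) =
      (if Int.fract ((b : ℝ) ^ (i + 1) * t) = 0 then 1 / 2 else 0) /
        (b : ℝ) ^ (α * ((i : ℝ) + 1)) := fun i => by
    rw [← sub_div, sawTooth]
    split_ifs with h
    · rw [h]; ring
    · ring
  -- All jumps have the same sign, so none cancels and the term carrying `b^n` alone gives the
  -- bound.
  have hle := (hs1.sub hs2).le_tsum (n - 1) fun i _ => by
    rw [key]
    have : 0 < (b : ℝ) ^ (α * ((i : ℝ) + 1)) := Real.rpow_pos_of_pos (by positivity) _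
    split_ifs <;> positivity
  refine le_trans (le_of_eq ?_) hle
  rw [key, Nat.sub_add_cancel hn, ht, Int.fract_intCast, if_pos rfl, Nat.cast_sub hn]
  simp

/-! ### The pointwise Hölder exponent of the Lévy function. -/

/-- Let `t = k / b^n` be within `b^(-n δ)` of `x`. A polynomial is continuous, so comparing the
value and the right limit of the function at `t` bounds the jump by `2 C |t - x|^β`. A jump of size
at least `b^(-α n) / 2` for infinitely many `n` forces `δ β ≤ α`. -/
lemma holderAtPoint_levy_le (hb : 2 ≤ b) {α β δ x : ℝ} (hα : 0 < α) (hδ : 1 ≤ δ)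
    (h : HolderAtPoint (levy b α) β x) (hx : x ∈ wellApprox b δ) : β ≤ α / δ := by
  have hb0 : (0 : ℝ) < b := by positivity
  have hb1 : (1 : ℝ) < b := by exact_mod_cast (by omega : 1 < b)
  by_contra! hlt
  have hβ : 0 < β := lt_trans (by positivity) hlt
  have hlt' : α < δ * β := by rwa [div_lt_iff₀' (by linarith)] at hlt
  obtain ⟨C, hC, r, hr, P, -, hP⟩ := h
  have hev1 := eventually_const_mul_rpow_lt hb (4 * C) hlt'
  have hev2 : ∀ᶠ n : ℕ in atTop, 1 / r * (b : ℝ) ^ (-((n : ℝ) * 1)) < (b : ℝ) ^ (-((n : ℝ) * 0)) :=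
    eventually_const_mul_rpow_lt hb _ one_pos
  obtain ⟨n, h1, h2, h3, h4⟩ :=
    (hx.and_eventually (hev1.and (hev2.and (eventually_ge_atTop 1)))).exists
  set k := round ((b : ℝ) ^ n * x)
  set t : ℝ := k / (b : ℝ) ^ n
  have hbn : (0 : ℝ) < (b : ℝ) ^ n := by positivity
  have hbt : (b : ℝ) ^ n * t = k := by simp only [t]; field_simp
  have htx : |t - x| ≤ (b : ℝ) ^ (-((n : ℝ) * δ)) := by
    have e1 : distInt ((b : ℝ) ^ n * x) = (b : ℝ) ^ n * |t - x| := by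
      rw [distInt, ← abs_of_pos hbn, ← abs_mul, mul_sub, abs_of_pos hbn, hbt, abs_sub_comm]
    rw [e1, ← le_div_iff₀' hbn] at h1
    refine h1.trans (le_of_eq ?_)
    rw [one_div, ← Real.rpow_neg hb0.le, ← Real.rpow_natCast, ← Real.rpow_sub hb0]
    congr 1; ring
  have htr : |t - x| < r := by
    refine lt_of_le_of_lt (htx.trans ?_) (b := (b : ℝ) ^ (-((n : ℝ) * 1))) ?_
    · refine Real.rpow_le_rpow_of_exponent_le hb1.le ?_
      have : (n : ℝ) * 1 ≤ n * δ := by gcongr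
      linarith
    · rw [mul_zero, neg_zero, Real.rpow_zero, one_div, inv_mul_lt_iff₀ hr, mul_one r] at h3
      exact h3
  obtain ⟨hx1, hx2⟩ := abs_lt.1 htr
  have ht := hP t ⟨by linarith, by linarith⟩
  set R := ∑' i : ℕ, (Int.fract ((b : ℝ) ^ (i + 1) * t) - 1 / 2) / (b : ℝ) ^ (α * ((i : ℝ) + 1))
  have hR : |R - P.eval (t - x)| ≤ C * |t - x| ^ β := by
    have l1 : Tendsto (fun u => |levy b α u - P.eval (u - x)|) (𝓝[>] t)
        (𝓝 |R - P.eval (t - x)|) := by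
      refine ((tendsto_levy_right hb hα t).sub ?_).abs
      exact (P.continuous.comp (continuous_id.sub continuous_const)).continuousWithinAt
    have l2 : Tendsto (fun u => C * |u - x| ^ β) (𝓝[>] t) (𝓝 (C * |t - x| ^ β)) := by
      refine Tendsto.mono_left ?_ nhdsWithin_le_nhds
      refine (Continuous.tendsto ?_ t)
      exact continuous_const.mul ((continuous_id.sub continuous_const).abs.rpow_const
        fun _ => Or.inr hβ.le)
    refine le_of_tendsto_of_tendsto l1 l2 ?_
    filter_upwards [Ioo_mem_nhdsGT (by linarith : t < x + r)] with u hu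
    exact hP u ⟨by linarith [hu.1], hu.2.le⟩
  have hjump := levy_sub_right_limit_ge hb hα h4 hbt
  have hle : 1 / 2 / (b : ℝ) ^ (α * n) ≤ 2 * C * (b : ℝ) ^ (-((n : ℝ) * (δ * β))) := by
    have e2 : |t - x| ^ β ≤ (b : ℝ) ^ (-((n : ℝ) * (δ * β))) := by
      refine (Real.rpow_le_rpow (abs_nonneg _) htx hβ.le).trans (le_of_eq ?_)
      rw [← Real.rpow_mul hb0.le]; congr 1; ring
    have e3 := mul_le_mul_of_nonneg_left e2 hC.le
    have e4 := (abs_le.1 ht).2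
    have e5 := (abs_le.1 hR).1
    linarith
  have e6 : 1 / 2 / (b : ℝ) ^ (α * n) = 1 / 2 * (b : ℝ) ^ (-((n : ℝ) * α)) := by
    rw [Real.rpow_neg hb0.le, mul_comm α, div_eq_mul_inv]
  rw [e6] at hle
  linarith

/-- A point which is not `δ`-well approximable satisfies a uniform Diophantine lower bound. -/
lemma exists_forall_le_distInt (hb : 2 ≤ b) {x δ : ℝ} (hδ : 1 ≤ δ) (hx : x ∉ wellApprox b δ) :
    ∃ c > 0, ∀ i : ℕ, c * (b : ℝ) ^ (-((i : ℝ) * (δ - 1))) ≤ distInt ((b : ℝ) ^ i * x) := by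
  have hb0 : (0 : ℝ) < b := by positivity
  have hb1 : (1 : ℝ) ≤ b := by exact_mod_cast (by omega : 1 ≤ b)
  obtain ⟨N, hN⟩ := eventually_atTop.1 (not_frequently.1 hx)
  have hN' : ∀ n ≥ N, (b : ℝ) ^ (-((n : ℝ) * (δ - 1))) ≤ distInt ((b : ℝ) ^ n * x) := fun n hn => by
    have := hN n hn
    rw [not_le, one_div, ← Real.rpow_neg hb0.le] at this
    exact this.le
  -- The bound at time `N` is carried back to the finitely many earlier times, losing at most `b^N`.
  set c := (b : ℝ) ^ (-((N : ℝ) * (δ - 1))) / (b : ℝ) ^ N with hc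
  have hrp : ∀ i : ℕ, (b : ℝ) ^ (-((i : ℝ) * (δ - 1))) ≤ 1 := fun i =>
    Real.rpow_le_one_of_one_le_of_nonpos hb1
      (neg_nonpos.2 (mul_nonneg (Nat.cast_nonneg _) (by linarith)))
  have hc0 : 0 < c := div_pos (Real.rpow_pos_of_pos hb0 _) (by positivity)
  have hc1 : c ≤ 1 := div_le_one_of_le₀ ((hrp N).trans (one_le_pow₀ hb1)) (by positivity)
  refine ⟨c, hc0, fun i => ?_⟩
  have hpos : 0 ≤ (b : ℝ) ^ (-((i : ℝ) * (δ - 1))) := (Real.rpow_pos_of_pos hb0 _).le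
  rcases le_total N i with hi | hi
  · exact (mul_le_of_le_one_left hpos hc1).trans (hN' i hi)
  · refine (mul_le_of_le_one_right hc0.le (hrp i)).trans (le_trans ?_ (distInt_orbit_ge hb hi x))
    exact div_le_div₀ (distInt_nonneg _) (hN' N le_rfl) (by positivity)
      (pow_le_pow_right₀ hb1 (Nat.sub_le _ _))

/-- Fix `u` and compare frequencies with `t = |u - x|`. As long as `b^((i+1) δ) t < c`, the points
`b^(i+1) u` and `b^(i+1) x` lie on the same branch, and the increment is exactly linear; beyond that
it is at most `1`. In both regimes the `i`-th error is at most a constant times `t^β` times a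
geometric factor, whose summability is paid for by `γ`. -/
lemma holderAtPoint_levy (hb : 2 ≤ b) {α γ δ x : ℝ} (hγ : 0 < γ) (hγα : γ < α)
    (hδ : 1 ≤ δ) (hx : x ∉ wellApprox b δ) : HolderAtPoint (levy b α) ((α - γ) / δ) x := by
  have hb0 : (0 : ℝ) < b := by positivity
  have hb1 : (1 : ℝ) < b := by exact_mod_cast (by omega : 1 < b)
  have hα : 0 < α := hγ.trans hγα
  obtain ⟨c, hc, hcx⟩ := exists_forall_le_distInt hb hδ hx
  set β := (α - γ) / δ with hβdef
  have hβ : 0 < β := div_pos (by linarith) (by linarith)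
  have hδβ : δ * β = α - γ := by rw [hβdef]; field_simp
  -- The linear part is subtracted only when `β > 1`: for `β ≤ 1` a polynomial of degree less than
  -- `β` is constant.
  set σ : ℝ := if β ≤ 1 then 0 else 1 with hσ
  set w : ℕ → ℝ := fun i => (b : ℝ) ^ (α * ((i : ℝ) + 1)) with hw
  set g : ℕ → ℝ := fun i => ((b : ℝ) ^ (γ * ((i : ℝ) + 1)))⁻¹ with hg
  have hw0 : ∀ i, 0 < w i := fun i => Real.rpow_pos_of_pos hb0 _
  have hg0 : ∀ i, 0 < g i := fun i => inv_pos.2 (Real.rpow_pos_of_pos hb0 _)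
  have hgs : Summable g := summable_inv_rpow_mul_succ hb hγ
  set M := c ^ (-β) + c ^ (1 - β) with hM
  have hcβ : 0 < c ^ (-β) := Real.rpow_pos_of_pos hc _
  have hcβ' : 0 < c ^ (1 - β) := Real.rpow_pos_of_pos hc _
  have hterm : ∀ u i, |sawTooth ((b : ℝ) ^ (i + 1) * u) - sawTooth ((b : ℝ) ^ (i + 1) * x) -
      σ * (b : ℝ) ^ (i + 1) * (u - x)| / w i ≤ M * |u - x| ^ β * g i := by
    intro u i
    rcases eq_or_ne u x with rfl | hne
    · have : 0 ≤ M * |u - u| ^ β * g i :=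
        mul_nonneg (mul_nonneg (by positivity) (by positivity)) (hg0 i).le
      simpa using this
    set t := |u - x| with ht
    have ht0 : 0 < t := abs_pos.2 (sub_ne_zero.2 hne)
    set Q := (b : ℝ) ^ (((i : ℝ) + 1) * δ) with hQ
    have hQ0 : 0 < Q := Real.rpow_pos_of_pos hb0 _
    have hbQ : (b : ℝ) ^ (i + 1) ≤ Q := by
      rw [← Real.rpow_natCast, hQ]
      refine Real.rpow_le_rpow_of_exponent_le hb1.le ?_
      push_cast
      nlinarith [(Nat.cast_nonneg i : (0 : ℝ) ≤ i)]
    have hwQ : (w i)⁻¹ = g i * Q ^ (-β) := by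
      simp only [hw, hg, hQ]
      rw [← Real.rpow_neg hb0.le, ← Real.rpow_neg hb0.le, ← Real.rpow_mul hb0.le,
        ← Real.rpow_add hb0]
      congr 1
      linear_combination (-((i : ℝ) + 1)) * (-1) * hδβ
    have hB : (w i)⁻¹ = g i * t ^ β * (Q * t) ^ (-β) := by
      rw [hwQ, Real.mul_rpow hQ0.le ht0.le, Real.rpow_neg ht0.le]
      have := Real.rpow_pos_of_pos ht0 β
      field_simp
    have hA : Q * t * (w i)⁻¹ = g i * t ^ β * (Q * t) ^ (1 - β) := by
      rw [hB, sub_eq_add_neg, Real.rpow_add (by positivity), Real.rpow_one]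
      ring
    have htβ : 0 < t ^ β := Real.rpow_pos_of_pos ht0 β
    have hvs : |(b : ℝ) ^ (i + 1) * u - (b : ℝ) ^ (i + 1) * x| = (b : ℝ) ^ (i + 1) * t := by
      rw [← mul_sub, abs_mul, abs_of_pos (by positivity)]
    rw [div_eq_mul_inv]
    have hwi : 0 < (w i)⁻¹ := inv_pos.2 (hw0 i)
    have hgt : 0 ≤ g i * t ^ β := mul_nonneg (hg0 i).le htβ.le
    have hlin : (b : ℝ) ^ (i + 1) * t * (w i)⁻¹ ≤ g i * t ^ β * (Q * t) ^ (1 - β) := by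
      rw [← hA]; gcongr
    -- Low frequencies, which meet no discontinuity, against high frequencies.
    rcases lt_or_ge (Q * t) c with hlt | hge
    · have hsmall : |(b : ℝ) ^ (i + 1) * u - (b : ℝ) ^ (i + 1) * x| <
          distInt ((b : ℝ) ^ (i + 1) * x) := by
        refine lt_of_lt_of_le ?_ (hcx (i + 1))
        rw [hvs]
        have e1 : (b : ℝ) ^ (-(((i + 1 : ℕ) : ℝ) * (δ - 1))) = (b : ℝ) ^ (i + 1) * Q⁻¹ := by
          rw [hQ, ← Real.rpow_neg hb0.le, ← Real.rpow_natCast, ← Real.rpow_add hb0]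
          congr 1; push_cast; ring
        rw [e1]
        have : t < c * Q⁻¹ := by rw [← div_eq_mul_inv, lt_div_iff₀ hQ0]; linarith
        calc (b : ℝ) ^ (i + 1) * t < (b : ℝ) ^ (i + 1) * (c * Q⁻¹) :=
              mul_lt_mul_of_pos_left this (by positivity)
          _ = _ := by ring
      rw [sawTooth_sub_of_lt_distInt hsmall]
      by_cases hβ1 : β ≤ 1
      · rw [hσ, if_pos hβ1, zero_mul, zero_mul, sub_zero, hvs]
        have e2 : (Q * t) ^ (1 - β) ≤ M :=
          (Real.rpow_le_rpow (by positivity) hlt.le (by linarith)).trans (by rw [hM]; linarith)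
        calc _ ≤ g i * t ^ β * (Q * t) ^ (1 - β) := hlin
          _ ≤ g i * t ^ β * M := mul_le_mul_of_nonneg_left e2 hgt
          _ = _ := by ring
      · rw [hσ, if_neg hβ1, one_mul, ← mul_sub, sub_self, abs_zero, zero_mul]
        have : 0 ≤ M := by positivity
        exact mul_nonneg (mul_nonneg this htβ.le) (hg0 i).le
    · have hsaw : |sawTooth ((b : ℝ) ^ (i + 1) * u) - sawTooth ((b : ℝ) ^ (i + 1) * x)| ≤ 1 := by
        refine (abs_sub _ _).trans ?_
        linarith [abs_sawTooth_le ((b : ℝ) ^ (i + 1) * u), abs_sawTooth_le ((b : ℝ) ^ (i + 1) * x)]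
      have e3 : (Q * t) ^ (-β) ≤ c ^ (-β) :=
        Real.rpow_le_rpow_of_nonpos hc hge (by linarith)
      have e4 : σ * ((b : ℝ) ^ (i + 1) * t * (w i)⁻¹) ≤ g i * t ^ β * c ^ (1 - β) := by
        by_cases hβ1 : β ≤ 1
        · rw [hσ, if_pos hβ1, zero_mul]; exact mul_nonneg hgt hcβ'.le
        · rw [hσ, if_neg hβ1, one_mul]
          exact hlin.trans (mul_le_mul_of_nonneg_left
            (Real.rpow_le_rpow_of_nonpos hc hge (by linarith)) hgt)
      have hσ0 : 0 ≤ σ := by rw [hσ]; split_ifs <;> norm_num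
      calc _ ≤ (1 + σ * ((b : ℝ) ^ (i + 1) * t)) * (w i)⁻¹ := by
            refine mul_le_mul_of_nonneg_right ((abs_sub _ _).trans (add_le_add hsaw ?_)) hwi.le
            rw [abs_mul, abs_mul, abs_of_nonneg hσ0, abs_of_pos (by positivity), mul_assoc]
        _ = (w i)⁻¹ + σ * ((b : ℝ) ^ (i + 1) * t * (w i)⁻¹) := by ring
        _ ≤ g i * t ^ β * c ^ (-β) + g i * t ^ β * c ^ (1 - β) := by
            refine add_le_add ?_ e4
            rw [hB]; exact mul_le_mul_of_nonneg_left e3 hgt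
        _ = _ := by rw [hM]; ring
  have hslope : Summable fun i : ℕ => σ * (b : ℝ) ^ (i + 1) / w i := by
    by_cases hβ1 : β ≤ 1
    · simp only [hσ, if_pos hβ1, zero_mul, zero_div]; exact summable_zero
    -- Since `α - γ = δ β` exceeds `1`, the formal derivative series converges.
    · have hα1 : 0 < α - 1 := by nlinarith
      refine (summable_inv_rpow_mul_succ hb hα1).congr fun i => ?_
      rw [hσ, if_neg hβ1, one_mul, hw, ← Real.rpow_natCast, ← Real.rpow_neg hb0.le,
        ← Real.rpow_sub hb0]
      congr 1; push_cast; ring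
  set S := ∑' i : ℕ, σ * (b : ℝ) ^ (i + 1) / w i with hS
  have hM0 : 0 < M := by positivity
  refine ⟨M * ∑' i, g i + 1, add_pos_of_nonneg_of_pos (mul_nonneg hM0.le
    (tsum_nonneg fun i => (hg0 i).le)) one_pos, 1, one_pos,
    Polynomial.C (levy b α x) + Polynomial.C S * Polynomial.X, ?_, ?_⟩
  · intro k hk
    rcases k with _ | _ | k
    · simpa using hβ
    · by_contra hle
      have hβ1 : β ≤ 1 := by simpa using hle
      apply hk
      simp [hS, hσ, hβ1]
    · exfalso; apply hk
      simp
  · intro u _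
    have hs1 := summable_div_rpow hb hα (fun i => abs_sawTooth_le ((b : ℝ) ^ (i + 1) * u))
    have hs2 := summable_div_rpow hb hα (fun i => abs_sawTooth_le ((b : ℝ) ^ (i + 1) * x))
    have e1 : levy b α u - (Polynomial.C (levy b α x) + Polynomial.C S * Polynomial.X).eval (u - x)
        = ∑' i : ℕ, (sawTooth ((b : ℝ) ^ (i + 1) * u) - sawTooth ((b : ℝ) ^ (i + 1) * x) -
          σ * (b : ℝ) ^ (i + 1) * (u - x)) / w i := by
      have e2 : ∀ i : ℕ, (sawTooth ((b : ℝ) ^ (i + 1) * u) - sawTooth ((b : ℝ) ^ (i + 1) * x) -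
          σ * (b : ℝ) ^ (i + 1) * (u - x)) / w i =
          (sawTooth ((b : ℝ) ^ (i + 1) * u) / w i - sawTooth ((b : ℝ) ^ (i + 1) * x) / w i) -
          σ * (b : ℝ) ^ (i + 1) / w i * (u - x) := fun i => by ring
      rw [tsum_congr e2, (hs1.sub hs2).tsum_sub (hslope.mul_right _), hs1.tsum_sub hs2,
        tsum_mul_right]
      simp [levy, hS, hw]
      ring
    rw [e1]
    have hb' := tsum_of_norm_bounded (hgs.hasSum.mul_left (M * |u - x| ^ β))
      (f := fun i : ℕ => (sawTooth ((b : ℝ) ^ (i + 1) * u) - sawTooth ((b : ℝ) ^ (i + 1) * x) -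
          σ * (b : ℝ) ^ (i + 1) * (u - x)) / w i) fun i => by
        rw [Real.norm_eq_abs, abs_div, abs_of_pos (hw0 i)]
        exact hterm u i
    rw [Real.norm_eq_abs] at hb'
    refine hb'.trans ?_
    have : 0 ≤ |u - x| ^ β := by positivity
    nlinarith

/-- Boundedness supplies the exponent `0` when `invExponent` vanishes, where `holderAtPoint_levy`
gives nothing. -/
lemma holderAtPoint_levy_zero (hb : 2 ≤ b) {α : ℝ} (hα : 0 < α) (x : ℝ) :
    HolderAtPoint (levy b α) 0 x := by
  have hb0 : (0 : ℝ) < b := by positivity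
  have hs := summable_inv_rpow_mul_succ hb hα
  refine ⟨1 / 2 * ∑' i : ℕ, ((b : ℝ) ^ (α * ((i : ℝ) + 1)))⁻¹ + 1,
    add_pos_of_nonneg_of_pos (mul_nonneg (by norm_num)
    (tsum_nonneg fun i => by positivity)) one_pos, 1, one_pos, 0, by simp, fun u _ => ?_⟩
  have hb' := tsum_of_norm_bounded (hs.hasSum.mul_left (1 / 2))
    (f := fun i : ℕ => sawTooth ((b : ℝ) ^ (i + 1) * u) / (b : ℝ) ^ (α * ((i : ℝ) + 1)))
    fun i => by
      have : 0 < (b : ℝ) ^ (α * ((i : ℝ) + 1)) := Real.rpow_pos_of_pos hb0 _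
      rw [Real.norm_eq_abs, abs_div, abs_of_pos this, div_eq_mul_inv]
      exact mul_le_mul_of_nonneg_right (abs_sawTooth_le _) (by positivity)
  rw [Real.norm_eq_abs] at hb'
  simp only [Polynomial.eval_zero, sub_zero, Real.rpow_zero, mul_one]
  exact hb'.trans (by linarith)

/-- The pointwise Hölder exponent of the Lévy function. -/
theorem holderExponent_levy (hb : 2 ≤ b) {α : ℝ} (hα : 0 < α) (x : ℝ) :
    holderExponent (levy b α) x = ((α * invExponent b x : ℝ) : EReal) := by
  refine IsLUB.sSup_eq ⟨?_, ?_⟩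
  · rintro _ ⟨β, ⟨hβ0, hβ⟩, rfl⟩
    have : β / α ≤ invExponent b x := le_invExponent fun δ hδ hx => by
      have := holderAtPoint_levy_le hb hα hδ hβ hx
      rw [div_le_iff₀ hα]
      calc β ≤ α / δ := this
        _ = _ := by ring
    rw [div_le_iff₀' hα] at this
    exact EReal.coe_le_coe_iff.2 this
  · intro u hu
    rcases (invExponent_nonneg (b := b) x).eq_or_lt with h0 | h0
    · rw [← h0, mul_zero]
      exact hu ⟨0, ⟨le_rfl, holderAtPoint_levy_zero hb hα x⟩, rfl⟩
    refine le_of_forall_lt fun d hd => ?_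
    obtain ⟨q, hq1, hq2⟩ := EReal.lt_iff_exists_real_btwn.1 hd
    have hq3 : q < α * invExponent b x := by exact_mod_cast hq2
    set κ := invExponent b x
    set q' := (max q 0 + α * κ) / 2 with hq'
    have hακ : 0 < α * κ := mul_pos hα h0
    have hmax : max q 0 < α * κ := max_lt hq3 hακ
    have hq0 : 0 < q' := by have := le_max_right q 0; rw [hq']; linarith
    have hqq : q < q' := by have := le_max_left q 0; rw [hq']; linarith
    have hqκ : q' < α * κ := by rw [hq']; linarith
    have hκ1 : κ ≤ 1 := invExponent_le_one x
    set κ' := (q' / α + κ) / 2 with hκ'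
    have h1 : q' / α < κ := by rwa [div_lt_iff₀' hα]
    have h2 : 0 < q' / α := by positivity
    have h3 : q' / α < κ' := by rw [hκ']; linarith
    have h4 : κ' < κ := by rw [hκ']; linarith
    have h5 : 0 < κ' := h2.trans h3
    have h6 : 1 ≤ 1 / κ' := by rw [le_div_iff₀ h5]; linarith
    have hnot := notMem_wellApprox_of_lt (b := b) (x := x) h6 (by rwa [one_div_one_div])
    have h7 : q' < α * κ' := by rwa [div_lt_iff₀' hα] at h3
    -- With `δ = 1 / κ'`, this `γ` makes the exponent `(α - γ) / δ` equal to `q'`.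
    have hH := holderAtPoint_levy hb (γ := α - q' / κ')
      (by rw [sub_pos, div_lt_iff₀ h5]; exact h7)
      (sub_lt_self α (by positivity)) h6 hnot
    have h8 : (α - (α - q' / κ')) / (1 / κ') = q' := by field_simp; ring
    rw [h8] at hH
    exact hq1.trans_le (le_trans (EReal.coe_le_coe_iff.2 hqq.le) (hu ⟨q', ⟨hq0.le, hH⟩, rfl⟩))

theorem holderExponent_levyTranslate (hb : 2 ≤ b) {α : ℝ} (hα : 0 < α) (y x : ℝ) :
    holderExponent (levyTranslate b α y) x = ((α * invExponent b (x - y) : ℝ) : EReal) := by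
  rw [← holderExponent_levy hb hα]
  unfold holderExponent
  congr 2
  ext β
  refine and_congr_right fun _ => ?_
  constructor
  · rintro ⟨C, hC, r, hr, P, hP, h⟩
    refine ⟨C, hC, r, hr, P, hP, fun v hv => ?_⟩
    have := h (v + y) ⟨by linarith [hv.1], by linarith [hv.2]⟩
    rwa [levyTranslate_eq, add_sub_cancel_right, show v + y - x = v - (x - y) by ring] at this
  · rintro ⟨C, hC, r, hr, P, hP, h⟩
    refine ⟨C, hC, r, hr, P, hP, fun v hv => ?_⟩
    have := h (v - y) ⟨by linarith [hv.1], by linarith [hv.2]⟩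
    rwa [show v - y - (x - y) = v - x by ring] at this

/-! ### Upper bound for the dimension. -/

-- At level `n`, about `b^n` balls of radius `b^(-n δ)` are needed; their `d`-dimensional sum is of
-- order `b^(n (1 - d δ))`, geometrically small as `d δ > 1`. Summing over all levels from `j` on
-- bounds the Hausdorff measure uniformly in `j`.
open MeasureTheory in
lemma dimH_wellApprox_inter_le (hb : 2 ≤ b) {δ d : ℝ} (hδ : 1 ≤ δ) (hd : 1 < d * δ) :
    dimH (wellApprox b δ ∩ Set.Icc 0 1) ≤ ENNReal.ofReal d := by
  have hb0 : (0 : ℝ) < b := by positivity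
  have hb1 : (1 : ℝ) < b := by exact_mod_cast (by omega : 1 < b)
  have hd0 : 0 < d := pos_of_mul_pos_left (one_pos.trans hd) (by linarith)
  rw [ENNReal.ofReal]
  refine dimH_le_of_hausdorffMeasure_ne_top ?_
  rw [Real.coe_toNNReal _ hd0.le]
  set q := (b : ℝ) ^ (1 - d * δ) with hq
  have hq0 : 0 < q := Real.rpow_pos_of_pos hb0 _
  have hq1 : q < 1 := Real.rpow_lt_one_of_one_lt_of_neg hb1 (by linarith)
  set ρ : ℕ → ℝ := fun n => 2 * (b : ℝ) ^ (-((n : ℝ) * δ)) with hρ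
  have hρ0 : ∀ n, 0 < ρ n := fun n => mul_pos two_pos (Real.rpow_pos_of_pos hb0 _)
  have hρle : ∀ n, ρ n ≤ 2 * ((b : ℝ)⁻¹) ^ n := fun n => by
    refine mul_le_mul_of_nonneg_left ?_ zero_le_two
    rw [← Real.rpow_natCast, Real.inv_rpow hb0.le, ← Real.rpow_neg hb0.le]
    exact Real.rpow_le_rpow_of_exponent_le hb1.le (by
      have : (n : ℝ) * 1 ≤ n * δ := by gcongr
      linarith)
  have hlim : Tendsto (fun j : ℕ => 2 * ((b : ℝ)⁻¹) ^ j) atTop (𝓝 0) := by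
    simpa using (tendsto_pow_atTop_nhds_zero_of_lt_one (by positivity)
      (inv_lt_one_of_one_lt₀ hb1)).const_mul (2 : ℝ)
  let ι : ℕ → Type := fun j => Σ n : ℕ, Fin (b ^ (n + j) + 1)
  let T : ∀ j, ι j → Set ℝ := fun j i =>
    Metric.closedBall ((i.2 : ℕ) / (b : ℝ) ^ (i.1 + j)) (ρ (i.1 + j) / 2)
  have hdiam : ∀ j i, Metric.ediam (T j i) ≤ ENNReal.ofReal (ρ (i.1 + j)) := fun j i => by
    refine Metric.ediam_le_of_forall_dist_le fun x hx y hy => ?_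
    have := dist_triangle_right x y ((i.2 : ℕ) / (b : ℝ) ^ (i.1 + j))
    have h1 := Metric.mem_closedBall.1 hx
    have h2 := Metric.mem_closedBall.1 hy
    linarith
  have hmain := Measure.hausdorffMeasure_le_liminf_tsum (ι := ι) d
    (wellApprox b δ ∩ Set.Icc (0 : ℝ) 1) (l := atTop)
    (fun j : ℕ => ENNReal.ofReal (2 * ((b : ℝ)⁻¹) ^ j))
    (by simpa using ENNReal.tendsto_ofReal hlim) T
    (Eventually.of_forall fun j i => (hdiam j i).trans (ENNReal.ofReal_le_ofReal
      ((hρle _).trans (mul_le_mul_of_nonneg_left (pow_le_pow_of_le_one (by positivity)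
        (inv_lt_one_of_one_lt₀ hb1).le (Nat.le_add_left _ _)) zero_le_two))))
    (Eventually.of_forall fun j x hx => ?_)
  · refine ne_top_of_le_ne_top ?_ hmain
    set D := 2 * 2 ^ d * (1 - q)⁻¹ with hD
    have hbound : ∀ j, ∑' i, Metric.ediam (T j i) ^ d ≤ ENNReal.ofReal D := fun j => by
      have h1 : ∀ i : ι j, Metric.ediam (T j i) ^ d ≤ ENNReal.ofReal (ρ (i.1 + j) ^ d) := fun i => by
        rw [← ENNReal.ofReal_rpow_of_pos (hρ0 _)]
        exact ENNReal.rpow_le_rpow (hdiam j i) hd0.le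
      refine (ENNReal.tsum_le_tsum h1).trans ?_
      rw [ENNReal.tsum_sigma']
      have h2 : ∀ n : ℕ, ∑' k : Fin (b ^ (n + j) + 1), ENNReal.ofReal (ρ (n + j) ^ d) ≤
          ENNReal.ofReal (2 * 2 ^ d * q ^ n) := fun n => by
        rw [tsum_fintype, Finset.sum_const, Finset.card_univ, Fintype.card_fin, nsmul_eq_mul,
          ← ENNReal.ofReal_natCast, ← ENNReal.ofReal_mul (by positivity)]
        refine ENNReal.ofReal_le_ofReal ?_
        have h3 : ((b ^ (n + j) + 1 : ℕ) : ℝ) ≤ 2 * (b : ℝ) ^ (n + j) := by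
          push_cast
          linarith [one_le_pow₀ hb1.le (n := n + j)]
        have h4 : ρ (n + j) ^ d * (b : ℝ) ^ (n + j) = 2 ^ d * q ^ (n + j) := by
          rw [hρ, Real.mul_rpow zero_le_two (Real.rpow_pos_of_pos hb0 _).le,
            ← Real.rpow_mul hb0.le, hq, ← Real.rpow_natCast, ← Real.rpow_natCast,
            ← Real.rpow_mul hb0.le, mul_assoc, ← Real.rpow_add hb0]
          congr 2; push_cast; ring
        have h5 : q ^ (n + j) ≤ q ^ n := pow_le_pow_of_le_one hq0.le hq1.le (Nat.le_add_right _ _)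
        have h6 : (0 : ℝ) < 2 ^ d := Real.rpow_pos_of_pos two_pos _
        have h7 : 0 < ρ (n + j) ^ d := Real.rpow_pos_of_pos (hρ0 _) _
        calc _ ≤ 2 * (b : ℝ) ^ (n + j) * ρ (n + j) ^ d := mul_le_mul_of_nonneg_right h3 h7.le
          _ = 2 * (2 ^ d * q ^ (n + j)) := by rw [← h4]; ring
          _ ≤ 2 * (2 ^ d * q ^ n) := by gcongr
          _ = _ := by ring
      refine (ENNReal.tsum_le_tsum h2).trans ?_
      rw [← ENNReal.ofReal_tsum_of_nonneg (fun n => by positivity)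
        ((summable_geometric_of_lt_one hq0.le hq1).mul_left _), tsum_mul_left,
        tsum_geometric_of_lt_one hq0.le hq1]
    exact ne_top_of_le_ne_top ENNReal.ofReal_ne_top
      (liminf_le_of_frequently_le' (Frequently.of_forall hbound))
  · obtain ⟨n, hn, hle⟩ := (frequently_atTop.1 hx.1) j
    have hbn : (0 : ℝ) < (b : ℝ) ^ n := by positivity
    set k := round ((b : ℝ) ^ n * x) with hk
    have hk0 : 0 ≤ k := by
      rw [hk, round_eq]
      exact Int.floor_nonneg.2 (by have := hx.2.1; positivity)
    have hk1 : k ≤ (b : ℤ) ^ n := by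
      rw [hk, round_eq]
      have h1 : (b : ℝ) ^ n * x ≤ (b : ℝ) ^ n := mul_le_of_le_one_right hbn.le hx.2.2
      have h2 : ⌊(b : ℝ) ^ n * x + 1 / 2⌋ < (b : ℤ) ^ n + 1 :=
        Int.floor_lt.2 (by push_cast; linarith)
      omega
    obtain ⟨K, hK⟩ := Int.eq_ofNat_of_zero_le hk0
    have hKn : K < b ^ (n - j + j) + 1 := by
      rw [Nat.sub_add_cancel hn]
      rw [hK] at hk1
      exact Nat.lt_succ_of_le (by exact_mod_cast hk1)
    refine Set.mem_iUnion.2 ⟨⟨n - j, ⟨K, hKn⟩⟩, ?_⟩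
    simp only [T, Metric.mem_closedBall, Nat.sub_add_cancel hn, hρ, Real.dist_eq]
    have e1 : distInt ((b : ℝ) ^ n * x) = (b : ℝ) ^ n * |x - K / (b : ℝ) ^ n| := by
      rw [distInt, ← hk, hK, ← abs_of_pos hbn, ← abs_mul, mul_sub, abs_of_pos hbn,
        mul_div_cancel₀ _ hbn.ne']
      simp
    rw [e1, ← le_div_iff₀' hbn] at hle
    rw [mul_div_cancel_left₀ _ (two_ne_zero)]
    refine hle.trans (le_of_eq ?_)
    rw [one_div, ← Real.rpow_neg hb0.le, ← Real.rpow_natCast, ← Real.rpow_sub hb0]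
    congr 1; ring

lemma dimH_wellApprox_le (hb : 2 ≤ b) {δ d : ℝ} (hδ : 1 ≤ δ) (hd : 1 < d * δ) :
    dimH (wellApprox b δ) ≤ ENNReal.ofReal d := by
  have hcov : wellApprox b δ ⊆
      ⋃ z : ℤ, (IsometryEquiv.addRight (z : ℝ)) '' (wellApprox b δ ∩ Set.Icc 0 1) := fun x hx => by
    refine Set.mem_iUnion.2 ⟨⌊x⌋, Int.fract x, ⟨?_, Int.fract_nonneg x, (Int.fract_lt_one x).le⟩, ?_⟩
    · rw [← wellApprox_add_int _ _ ⌊x⌋, Int.fract_add_floor]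
      exact hx
    · simp
  refine (dimH_mono hcov).trans ?_
  rw [dimH_iUnion]
  refine iSup_le fun z => ?_
  rw [IsometryEquiv.dimH_image]
  exact dimH_wellApprox_inter_le hb hδ hd

/-- The set of points with inverse approximation exponent at most `a` has dimension at most `a`. -/
theorem dimH_invExponent_le (hb : 2 ≤ b) {a : ℝ} (ha₀ : 0 ≤ a) (ha₁ : a ≤ 1) :
    dimH {x : ℝ | invExponent b x ≤ a} ≤ ENNReal.ofReal a := by
  rcases ha₁.eq_or_lt with rfl | ha₁
  · rw [ENNReal.ofReal_one, ← Real.dimH_univ]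
    exact dimH_mono (Set.subset_univ _)
  have key : ∀ d, a < d → d < 1 →
      dimH {x : ℝ | invExponent b x ≤ a} ≤ ENNReal.ofReal d := fun d h1 h2 => by
    -- An intermediate value: `a < e` yields membership in `wellApprox b (1 / e)`, and `e < d` makes
    -- its covering sums converge.
    set e := (a + d) / 2 with he
    have he0 : 0 < e := by linarith
    have hδ : 1 ≤ 1 / e := by rw [le_div_iff₀ he0]; linarith
    refine (dimH_mono (t := wellApprox b (1 / e)) fun x hx => ?_).trans
      (dimH_wellApprox_le hb hδ ?_)
    · refine mem_wellApprox_of_lt hb hδ ?_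
      rw [one_div_one_div]
      exact lt_of_le_of_lt hx (by linarith)
    · rw [mul_one_div, lt_div_iff₀ he0]; linarith
  have hlim : Tendsto (fun d : ℝ => ENNReal.ofReal d) (𝓝[>] a) (𝓝 (ENNReal.ofReal a)) :=
    (ENNReal.continuous_ofReal.tendsto a).mono_left nhdsWithin_le_nhds
  refine ge_of_tendsto hlim ?_
  filter_upwards [Ioo_mem_nhdsGT ha₁] with d hd
  exact key d hd.1 hd.2

/-! ### Digit expansions and distances. -/

lemma exists_int_pow_mul_ofDigits {B : ℕ} (d : ℕ → Fin B) (m : ℕ) :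
    ∃ z : ℤ, (B : ℝ) ^ m * Real.ofDigits d = z + Real.ofDigits (fun i => d (i + m)) := by
  have hB : (B : ℝ) ≠ 0 := by exact_mod_cast (Fin.pos (d 0)).ne'
  refine ⟨∑ i ∈ Finset.range m, (d i : ℤ) * (B : ℤ) ^ (m - (i + 1)), ?_⟩
  rw [Real.ofDigits_eq_sum_add_ofDigits d m, mul_add, mul_inv_cancel_left₀ (pow_ne_zero _ hB),
    Finset.mul_sum]
  push_cast
  congr 1
  refine Finset.sum_congr rfl fun i hi => ?_
  have hi' : i + 1 ≤ m := Finset.mem_range.1 hi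
  rw [Real.ofDigitsTerm, pow_sub₀ _ hB hi']
  ring

lemma distInt_pow_mul_ofDigits {B : ℕ} (d : ℕ → Fin B) (m : ℕ) :
    distInt ((B : ℝ) ^ m * Real.ofDigits d) = distInt (Real.ofDigits fun i => d (i + m)) := by
  obtain ⟨z, hz⟩ := exists_int_pow_mul_ofDigits d m
  rw [hz, add_comm, distInt_add_int]

lemma distInt_pow_mul_ofDigits_sub {B : ℕ} (d d' : ℕ → Fin B) (m : ℕ) :
    distInt ((B : ℝ) ^ m * (Real.ofDigits d - Real.ofDigits d')) =
      distInt (Real.ofDigits (fun i => d (i + m)) - Real.ofDigits (fun i => d' (i + m))) := by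
  obtain ⟨z, hz⟩ := exists_int_pow_mul_ofDigits d m
  obtain ⟨z', hz'⟩ := exists_int_pow_mul_ofDigits d' m
  rw [mul_sub, hz, hz', ← distInt_add_int (Real.ofDigits _ - _) (z - z')]
  push_cast
  congr 1; ring

lemma mul_ofDigits {B : ℕ} (d : ℕ → Fin B) :
    (B : ℝ) * Real.ofDigits d = (d 0 : ℕ) + Real.ofDigits (fun i => d (i + 1)) := by
  have hB : (B : ℝ) ≠ 0 := by exact_mod_cast (Fin.pos (d 0)).ne'
  rw [Real.ofDigits_eq_sum_add_ofDigits d 1, mul_add, pow_one, mul_inv_cancel_left₀ hB]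
  simp [Real.ofDigitsTerm, hB, mul_comm (B : ℝ)]

lemma abs_ofDigits_sub_le_one {B : ℕ} (d d' : ℕ → Fin B) :
    |Real.ofDigits d - Real.ofDigits d'| ≤ 1 := by
  have := Real.ofDigits_nonneg d
  have := Real.ofDigits_nonneg d'
  have := Real.ofDigits_le_one d
  have := Real.ofDigits_le_one d'
  rw [abs_le]; constructor <;> linarith

/-- Two digits that are not cyclically adjacent modulo `B`. -/
def FarDigits {B : ℕ} (p q : Fin B) : Prop :=
  2 ≤ |((p : ℕ) : ℤ) - (q : ℕ)| ∧ |((p : ℕ) : ℤ) - (q : ℕ)| ≤ B - 2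

/-- Multiplying the shifted difference by `B` gives the difference of leading digits plus a tail of
size at most `1`. Cyclic separation keeps the result in absolute value between `1` and `B - 1`. -/
lemma distInt_ge_of_farDigits {B : ℕ} {d d' : ℕ → Fin B} {m : ℕ} (h : FarDigits (d m) (d' m)) :
    1 / (B : ℝ) ≤ distInt ((B : ℝ) ^ m * (Real.ofDigits d - Real.ofDigits d')) := by
  have hB : (0 : ℝ) < B := by exact_mod_cast (Fin.pos (d 0))
  rw [distInt_pow_mul_ofDigits_sub]
  set u := Real.ofDigits (fun i => d (i + m)) - Real.ofDigits (fun i => d' (i + m)) with hu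
  have e : (B : ℝ) * u = ((d m : ℕ) - (d' m : ℕ) : ℝ) +
      (Real.ofDigits (fun i => d (i + 1 + m)) - Real.ofDigits (fun i => d' (i + 1 + m))) := by
    rw [hu, mul_sub, mul_ofDigits, mul_ofDigits]
    simp only [zero_add]
    ring
  have ht := abs_ofDigits_sub_le_one (fun i => d (i + 1 + m)) (fun i => d' (i + 1 + m))
  set t := Real.ofDigits (fun i => d (i + 1 + m)) - Real.ofDigits (fun i => d' (i + 1 + m))
  have h1 : (2 : ℝ) ≤ |((d m : ℕ) - (d' m : ℕ) : ℝ)| := by exact_mod_cast h.1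
  have h2 : |((d m : ℕ) - (d' m : ℕ) : ℝ)| ≤ B - 2 := by exact_mod_cast h.2
  have h3 : |(B : ℝ) * u| = B * |u| := by rw [abs_mul, abs_of_pos hB]
  have h4 : 1 ≤ B * |u| := by
    rw [← h3, e]
    have := abs_sub_abs_le_abs_sub ((d m : ℕ) - (d' m : ℕ) : ℝ) (-t)
    rw [abs_neg, sub_neg_eq_add] at this
    linarith
  have h5 : B * |u| ≤ B - 1 := by
    rw [← h3, e]
    have := abs_add_le ((d m : ℕ) - (d' m : ℕ) : ℝ) t
    linarith
  refine distInt_abs_ge ?_ ?_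
  · rw [div_le_iff₀' hB]; exact h4
  · rw [← sub_nonneg]
    have : 0 ≤ (B - 1 - B * |u|) / B := div_nonneg (by linarith) hB.le
    have e2 : (B - 1 - B * |u|) / B = 1 - 1 / (B : ℝ) - |u| := by field_simp
    rwa [← e2]

lemma distInt_le_of_agree {B : ℕ} {d d' : ℕ → Fin B} {m S : ℕ}
    (h : ∀ i, m ≤ i → i < S → d i = d' i) :
    distInt ((B : ℝ) ^ m * (Real.ofDigits d - Real.ofDigits d')) ≤ ((B : ℝ) ^ (S - m))⁻¹ := by
  rw [distInt_pow_mul_ofDigits_sub]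
  refine (distInt_le_abs _).trans (Real.abs_ofDigits_sub_ofDigits_le fun i hi => ?_)
  exact h _ (by omega) (by omega)

/-- Distinct digits alone do not separate numbers, because of expansions such as `0.0999...` and
`0.1000...`. Excluding the extreme difference `B - 1` at the next digit leaves a gap `B - (B - 2) -
1 = 1` after scaling by `B^(m + 2)`. -/
lemma ofDigits_separation {B : ℕ} {d d' : ℕ → Fin B} {m : ℕ} (h : ∀ i < m, d i = d' i)
    (hm : d m ≠ d' m)
    (hm' : |((d (m + 1) : ℕ) : ℤ) - (d' (m + 1) : ℕ)| ≤ B - 2) :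
    ((B : ℝ) ^ (m + 2))⁻¹ ≤ |Real.ofDigits d - Real.ofDigits d'| := by
  have hB : (0 : ℝ) < B := by exact_mod_cast (Fin.pos (d 0))
  have hsum : ∑ i ∈ Finset.range m, Real.ofDigitsTerm d i =
      ∑ i ∈ Finset.range m, Real.ofDigitsTerm d' i :=
    Finset.sum_congr rfl fun i hi => by
      simp [Real.ofDigitsTerm, h i (Finset.mem_range.1 hi)]
  rw [Real.ofDigits_eq_sum_add_ofDigits d m, Real.ofDigits_eq_sum_add_ofDigits d' m, hsum,
    add_sub_add_left_eq_sub, ← mul_sub, abs_mul, abs_of_pos (by positivity), pow_add, mul_inv]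
  refine mul_le_mul_of_nonneg_left ?_ (by positivity)
  set u := Real.ofDigits (fun i => d (i + m)) - Real.ofDigits (fun i => d' (i + m)) with hu
  have e : (B : ℝ) ^ 2 * u = B * ((d m : ℕ) - (d' m : ℕ) : ℝ) +
      ((d (m + 1) : ℕ) - (d' (m + 1) : ℕ) : ℝ) +
      (Real.ofDigits (fun i => d (i + 2 + m)) - Real.ofDigits (fun i => d' (i + 2 + m))) := by
    rw [hu, pow_two, mul_assoc, mul_sub, mul_ofDigits, mul_ofDigits]
    have e1 := mul_ofDigits (fun i => d (i + 1 + m))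
    have e2 := mul_ofDigits (fun i => d' (i + 1 + m))
    simp only [zero_add, add_comm 1 m] at e1 e2 ⊢
    simp only [add_assoc, Nat.reduceAdd] at e1 e2 ⊢
    linear_combination e1 - e2
  have ht := abs_ofDigits_sub_le_one (fun i => d (i + 2 + m)) (fun i => d' (i + 2 + m))
  set t := Real.ofDigits (fun i => d (i + 2 + m)) - Real.ofDigits (fun i => d' (i + 2 + m))
  have h1 : (1 : ℝ) ≤ |((d m : ℕ) - (d' m : ℕ) : ℝ)| := by
    have : 1 ≤ |((d m : ℕ) : ℤ) - (d' m : ℕ)| := by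
      refine Int.one_le_abs (sub_ne_zero.2 fun h => hm (Fin.ext (by exact_mod_cast h)))
    exact_mod_cast this
  have h2 : |((d (m + 1) : ℕ) - (d' (m + 1) : ℕ) : ℝ)| ≤ B - 2 := by exact_mod_cast hm'
  have h3 : |(B : ℝ) ^ 2 * u| = (B : ℝ) ^ 2 * |u| := by rw [abs_mul, abs_of_pos (by positivity)]
  rw [inv_le_iff_one_le_mul₀' (by positivity), ← h3, e]
  set p := ((d m : ℕ) - (d' m : ℕ) : ℝ)
  set q := ((d (m + 1) : ℕ) - (d' (m + 1) : ℕ) : ℝ)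
  have h4 : |B * p| = B * |p| := by rw [abs_mul, abs_of_pos hB]
  have h5 := abs_sub_abs_le_abs_sub (B * p) (-(q + t))
  rw [abs_neg, sub_neg_eq_add, ← add_assoc, h4] at h5
  have h6 := abs_add_le q t
  have h7 : (B : ℝ) * 1 ≤ B * |p| := mul_le_mul_of_nonneg_left h1 hB.le
  linarith

/-! ### Dimension of digit sets with prescribed and free positions. -/

open Classical in
/-- The digit sequence which on the free positions `Fr` follows `ω` through the choice `e`, and
elsewhere equals `c`. -/
def mixDigits {B G : ℕ} (Fr : ℕ → Prop) (e : ℕ → Fin G → Fin B) (c : ℕ → Fin B) (ω : ℕ → Fin G) :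
    ℕ → Fin B :=
  fun m => if Fr m then e m (ω (Nat.count Fr m)) else c m

-- Reading off the free digits and interpreting them in base `G` maps the set onto `[0, 1]`. By
-- `ofDigits_separation` and the count of free positions this map is Hölder of exponent `r`, so the
-- set has dimension at least `r`.
open Classical in
lemma dimH_range_mixDigits {B G : ℕ} (hB : 2 ≤ B) (hG : 2 ≤ G) {Fr : ℕ → Prop}
    {e : ℕ → Fin G → Fin B} {c : ℕ → Fin B} (hFr : {m | Fr m}.Infinite)
    (he : ∀ m, Function.Injective (e m)) (he₂ : ∀ m g, 2 ≤ (e m g : ℕ))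
    {C r : ℝ} (hr : 0 < r) (hC : 0 ≤ C)
    (hcount : ∀ m, Fr m →
      ((G : ℝ) ^ Nat.count Fr m)⁻¹ ≤ C * (((B : ℝ) ^ (m + 2))⁻¹) ^ r) :
    ENNReal.ofReal r ≤ dimH (Set.range fun ω : ℕ → Fin G => Real.ofDigits (mixDigits Fr e c ω)) := by
  set X := fun ω : ℕ → Fin G => Real.ofDigits (mixDigits Fr e c ω) with hX
  have hB0 : (0 : ℝ) < B := by positivity
  have hG0 : (0 : ℝ) < G := by positivity
  have key : ∀ ω ω', |Real.ofDigits ω - Real.ofDigits ω'| ≤ C * |X ω - X ω'| ^ r := by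
    intro ω ω'
    by_cases hne : ω = ω'
    · subst hne
      rw [sub_self, abs_zero]
      exact mul_nonneg hC (by positivity)
    have hex : ∃ j, ω j ≠ ω' j := Function.ne_iff.1 hne
    set j := Nat.find hex
    have hj : ω j ≠ ω' j := Nat.find_spec hex
    have hlt : ∀ i < j, ω i = ω' i := fun i hi => by simpa using Nat.find_min hex hi
    set m := Nat.nth Fr j
    have hm : Fr m := Nat.nth_mem_of_infinite hFr j
    have hcm : Nat.count Fr m = j := Nat.count_nth_of_infinite hFr j
    refine (Real.abs_ofDigits_sub_ofDigits_le hlt).trans ?_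
    have h1 := hcount m hm
    rw [hcm] at h1
    refine h1.trans (mul_le_mul_of_nonneg_left (Real.rpow_le_rpow (by positivity) ?_ hr.le) hC)
    refine ofDigits_separation (m := m) (fun i hi => ?_) ?_ ?_
    · unfold mixDigits
      split_ifs with hFi
      · rw [hlt _ (by rw [← hcm]; exact Nat.count_strict_mono hFi hi)]
      · rfl
    · unfold mixDigits
      rw [if_pos hm, if_pos hm, hcm]
      exact fun h => hj (he m h)
    · unfold mixDigits
      split_ifs with hFi
      -- Free digits are at least `2`, so two of them never differ by `B - 1`.
      · have a1 := he₂ (m + 1) (ω (Nat.count Fr (m + 1)))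
        have a2 := he₂ (m + 1) (ω' (Nat.count Fr (m + 1)))
        have a3 := (e (m + 1) (ω (Nat.count Fr (m + 1)))).isLt
        have a4 := (e (m + 1) (ω' (Nat.count Fr (m + 1)))).isLt
        rw [abs_le]; constructor <;> omega
      · rw [sub_self, abs_zero]
        omega
  have : Nonempty (Fin G) := ⟨⟨0, by omega⟩⟩
  set f : ℝ → ℝ := fun x => Real.ofDigits (Function.invFun X x) with hf
  have hinv : ∀ ω, X (Function.invFun X (X ω)) = X ω := fun ω =>
    Function.invFun_eq ⟨ω, rfl⟩
  have hhold : HolderOnWith C.toNNReal r.toNNReal f (Set.range X) := by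
    rintro _ ⟨ω, rfl⟩ _ ⟨ω', rfl⟩
    have h := key (Function.invFun X (X ω)) (Function.invFun X (X ω'))
    rw [hinv, hinv] at h
    rw [edist_dist, edist_dist, Real.dist_eq, Real.dist_eq, Real.coe_toNNReal _ hr.le,
      ENNReal.ofReal_rpow_of_nonneg (abs_nonneg _) hr.le]
    change _ ≤ ENNReal.ofReal C * _
    rw [← ENNReal.ofReal_mul hC]
    exact ENNReal.ofReal_le_ofReal h
  have himg : Set.Icc (0 : ℝ) 1 ⊆ f '' Set.range X := by
    intro z hz
    obtain ⟨ω, -, rfl⟩ := Real.ofDigits_SurjOn (by omega : 1 < G) hz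
    refine ⟨X ω, ⟨ω, rfl⟩, ?_⟩
    -- The chosen code may differ from `ω`, but the Hölder estimate at distance zero shows that both
    -- have the same value in base `G`.
    have h := key (Function.invFun X (X ω)) ω
    rw [hinv, sub_self, abs_zero, Real.zero_rpow hr.ne', mul_zero] at h
    exact sub_eq_zero.1 (abs_nonpos_iff.1 h)
  have h1 : (1 : ENNReal) ≤ dimH (Set.Icc (0 : ℝ) 1) := by
    rw [Real.dimH_of_nonempty_interior (by rw [interior_Icc]; exact Set.nonempty_Ioo.2 one_pos)]
    simp
  have h2 := h1.trans ((dimH_mono himg).trans (hhold.dimH_image_le (Real.toNNReal_pos.2 hr)))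
  have hr0 : (r.toNNReal : ENNReal) ≠ 0 := by
    simpa using hr
  rwa [ENNReal.le_div_iff_mul_le (Or.inl hr0) (Or.inl ENNReal.coe_ne_top), one_mul] at h2

open Classical in
lemma card_not_farDigits_le {B : ℕ} (v : Fin B) :
    (Finset.univ.filter fun p : Fin B => ¬ FarDigits p v).card ≤ 5 := by
  have hsub : Finset.image Fin.val (Finset.univ.filter fun p : Fin B => ¬ FarDigits p v) ⊆
      {(v : ℕ), (v : ℕ) + 1, (v : ℕ) - 1, (v : ℕ) + (B - 1), (v : ℕ) - (B - 1)} := by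
    intro n hn
    obtain ⟨p, hp, rfl⟩ := Finset.mem_image.1 hn
    have hp' := (Finset.mem_filter.1 hp).2
    have h1 := p.isLt
    have h2 := v.isLt
    unfold FarDigits at hp'
    simp only [Finset.mem_insert, Finset.mem_singleton]
    rcases abs_cases (((p : ℕ) : ℤ) - (v : ℕ)) with ⟨h, h3⟩ | ⟨h, h3⟩ <;> rw [h] at hp' <;> omega
  calc _ = (Finset.image Fin.val (Finset.univ.filter fun p : Fin B => ¬ FarDigits p v)).card :=
        (Finset.card_image_of_injective _ Fin.val_injective).symm
    _ ≤ _ := Finset.card_le_card hsub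
    _ ≤ 5 := Finset.card_le_five

/-- Each of the two digits to avoid excludes at most five values, whence the margin of ten. -/
lemma exists_farDigits_embedding {B G : ℕ} (hG : G + 10 ≤ B) (v w : Fin B) :
    ∃ e : Fin G → Fin B, Function.Injective e ∧ ∀ g, FarDigits (e g) v ∧ FarDigits (e g) w := by
  classical
  set s := Finset.univ.filter fun p : Fin B => FarDigits p v ∧ FarDigits p w
  have hc : sᶜ ⊆ (Finset.univ.filter fun p : Fin B => ¬ FarDigits p v) ∪
      (Finset.univ.filter fun p : Fin B => ¬ FarDigits p w) := by
    intro p hp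
    simp only [s, Finset.mem_compl, Finset.mem_filter, Finset.mem_univ, true_and,
      Finset.mem_union] at hp ⊢
    tauto
  have h1 := (Finset.card_le_card hc).trans (Finset.card_union_le _ _)
  have h2 := card_not_farDigits_le v
  have h3 := card_not_farDigits_le w
  rw [Finset.card_compl, Fintype.card_fin] at h1
  have h4 : G ≤ s.card := by omega
  refine ⟨s.orderEmbOfCardLe h4, (s.orderEmbOfCardLe h4).injective, fun g => ?_⟩
  simpa [s] using s.orderEmbOfCardLe_mem h4 g

/-! ### Windows and the exponents they produce. -/

/-- The positions outside all windows `[s k, S k)`. -/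
def FreePos (s S : ℕ → ℕ) (m : ℕ) : Prop := ∀ k, ¬ (s k ≤ m ∧ m < S k)

lemma window_lt {s S : ℕ → ℕ} (h₁ : ∀ k, s k ≤ S k) (h₂ : ∀ k, S k < s (k + 1)) {j k : ℕ}
    (hjk : j < k) : S j < s k := by
  induction k, hjk using Nat.le_induction with
  | base => exact h₂ j
  | succ k _ ih => exact ih.trans_le ((h₁ k).trans (h₂ k).le)

lemma window_strictMono {s S : ℕ → ℕ} (h₁ : ∀ k, s k ≤ S k) (h₂ : ∀ k, S k < s (k + 1)) :
    StrictMono s := strictMono_nat_of_lt_succ fun k => (h₁ k).trans_lt (h₂ k)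

/-- The strict gap between windows leaves a free digit right after each one; there the agreement
with the copied model stops. -/
lemma freePos_right_end {s S : ℕ → ℕ} (h₁ : ∀ k, s k ≤ S k) (h₂ : ∀ k, S k < s (k + 1)) (k : ℕ) :
    FreePos s S (S k) := by
  rintro j ⟨hj1, hj2⟩
  rcases lt_trichotomy j k with h | rfl | h
  · have := window_lt h₁ h₂ h
    have := h₁ k
    omega
  · omega
  · have := window_lt h₁ h₂ h
    omega

open Classical in
/-- On windows of type `true` follow `V true`, elsewhere `V false`. -/
def windowDigits {B : ℕ} (V : Bool → ℕ → Fin B) (s S : ℕ → ℕ) (typ : ℕ → Bool) (m : ℕ) : Fin B :=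
  if ∃ k, (s k ≤ m ∧ m < S k) ∧ typ k = true then V true m else V false m

lemma windowDigits_eq {B : ℕ} (V : Bool → ℕ → Fin B) {s S : ℕ → ℕ} (typ : ℕ → Bool)
    (h₁ : ∀ k, s k ≤ S k) (h₂ : ∀ k, S k < s (k + 1)) {k m : ℕ} (hk : s k ≤ m ∧ m < S k) :
    windowDigits V s S typ m = V (typ k) m := by
  have huniq : ∀ j, (s j ≤ m ∧ m < S j) → j = k := fun j hj => by
    rcases lt_trichotomy j k with h | h | h
    · have := window_lt h₁ h₂ h; omega
    · exact h
    · have := window_lt h₁ h₂ h; omega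
  unfold windowDigits
  split_ifs with h
  · obtain ⟨j, hj, ht⟩ := h
    rw [← huniq j hj, ht]
  · have : typ k = false := by
      by_contra hne
      exact h ⟨k, hk, by simpa using hne⟩
    rw [this]

section Exponents

variable {K B : ℕ} {V : Bool → ℕ → Fin B} {D : ℕ → Fin B} {s S : ℕ → ℕ}
  {typ : ℕ → Bool}

/-- At a free position, far digits keep the orbit of `x - V τ` away from the integers. In a window
of type `τ`, the free digit at its end limits the approximation, by going back along the orbit. In a
window of the other type, `x` follows the other model, which `hV` keeps away from `V τ`. -/
lemma le_invExponent_of_windows (hb : 2 ≤ b) (hK : 0 < K) (hB : B = b ^ K)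
    (hfar : ∀ m, FreePos s S m → ∀ τ, FarDigits (D m) (V τ m))
    (hwin : ∀ k m, s k ≤ m → m < S k → D m = V (typ k) m)
    (hfree : ∀ k, FreePos s S (S k))
    (hV : ∀ k m, s k ≤ m → m < S k → 2 / (B : ℝ) ≤
      distInt ((B : ℝ) ^ m * (Real.ofDigits (V true) - Real.ofDigits (V false))))
    {τ : Bool} {A : ℝ} (hA : 1 ≤ A) (hρ : ∀ k, typ k = τ → (S k : ℝ) ≤ A * s k + 1) :
    1 / A ≤ invExponent b (Real.ofDigits D - Real.ofDigits (V τ)) := by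
  have hb0 : (0 : ℝ) < b := by positivity
  have hb1 : (1 : ℝ) ≤ b := by exact_mod_cast (by omega : 1 ≤ b)
  have hB2 : 2 ≤ B := hB ▸ hb.trans (Nat.le_self_pow hK.ne' b)
  have hBr : (B : ℝ) = (b : ℝ) ^ K := by rw [hB]; push_cast; rfl
  have hB0 : (0 : ℝ) < B := by positivity
  have hB1 : (1 : ℝ) ≤ B := by exact_mod_cast (by omega : 1 ≤ B)
  set x := Real.ofDigits D
  have hmain : ∀ m, ((B : ℝ) ^ 2)⁻¹ * (b : ℝ) ^ (-(((K * m : ℕ) : ℝ) * (A - 1))) ≤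
      distInt ((B : ℝ) ^ m * (x - Real.ofDigits (V τ))) := by
    intro m
    have hexp1 : (b : ℝ) ^ (-(((K * m : ℕ) : ℝ) * (A - 1))) ≤ 1 :=
      Real.rpow_le_one_of_one_le_of_nonpos hb1
        (neg_nonpos.2 (mul_nonneg (Nat.cast_nonneg _) (by linarith)))
    have hcoarse : 1 / (B : ℝ) ≤ distInt ((B : ℝ) ^ m * (x - Real.ofDigits (V τ))) →
        ((B : ℝ) ^ 2)⁻¹ * (b : ℝ) ^ (-(((K * m : ℕ) : ℝ) * (A - 1))) ≤
        distInt ((B : ℝ) ^ m * (x - Real.ofDigits (V τ))) := fun h => by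
      refine le_trans ?_ h
      refine (mul_le_of_le_one_right (by positivity) hexp1).trans ?_
      rw [one_div]
      exact inv_anti₀ hB0 (by nlinarith)
    by_cases hm : FreePos s S m
    · exact hcoarse (distInt_ge_of_farDigits (hfar m hm τ))
    simp only [FreePos, not_forall, not_not] at hm
    obtain ⟨k, hk1, hk2⟩ := hm
    by_cases hτ : typ k = τ
    · have h1 := distInt_ge_of_farDigits (hfar _ (hfree k) τ)
      have h2 := distInt_orbit_ge hB2 hk2.le (x - Real.ofDigits (V τ))
      refine le_trans ?_ (le_trans (div_le_div_of_nonneg_right h1 (by positivity)) h2)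
      -- One factor `B` comes from the bound at `S k`, the other from the `+ 1` in `hρ`.
      rw [div_div, one_div, ← mul_inv_cancel_left₀ hB0.ne' ((B : ℝ) ^ (S k - m)), ← mul_assoc,
        ← mul_assoc, ← pow_two, mul_assoc, mul_inv]
      refine mul_le_mul_of_nonneg_left ?_ (by positivity)
      have e1 : ((B : ℝ)⁻¹ * (B : ℝ) ^ (S k - m))⁻¹ = (b : ℝ) ^ (-((K : ℝ) * (S k - m - 1))) := by
        rw [hBr, mul_inv, inv_inv, ← pow_mul, ← Real.rpow_natCast, ← Real.rpow_natCast,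
          ← Real.rpow_neg hb0.le, ← Real.rpow_add hb0]
        congr 1
        push_cast [Nat.cast_sub hk2.le]
        ring
      rw [e1]
      refine Real.rpow_le_rpow_of_exponent_le hb1 (neg_le_neg ?_)
      push_cast
      rw [mul_assoc]
      refine mul_le_mul_of_nonneg_left ?_ (Nat.cast_nonneg _)
      have h3 := hρ k hτ
      have h4 : (s k : ℝ) ≤ m := by exact_mod_cast hk1
      have h5 : A * s k ≤ A * m := mul_le_mul_of_nonneg_left h4 (by linarith)
      linarith
    · refine hcoarse ?_
      -- The error of copying is at most `1 / B`, half of the separation `2 / B` of the two models.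
      have hag := distInt_le_of_agree (d := D) (d' := V (typ k)) (m := m) (S := S k)
        fun i hi1 hi2 => hwin k i (hk1.trans hi1) hi2
      have hV' : 2 / (B : ℝ) ≤ distInt ((B : ℝ) ^ m *
          (Real.ofDigits (V (typ k)) - Real.ofDigits (V τ))) := by
        have h0 := hV k m hk1 hk2
        cases ht : typ k <;> cases ht' : τ
        · simp [ht, ht'] at hτ
        · rw [← distInt_neg, ← mul_neg, neg_sub]; exact h0
        · exact h0
        · simp [ht, ht'] at hτ
      have h1 : ((B : ℝ) ^ (S k - m))⁻¹ ≤ 1 / B := by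
        rw [one_div]
        exact inv_anti₀ hB0 (le_self_pow₀ hB1 (by omega))
      have h2 := distInt_sub_le ((B : ℝ) ^ m * (x - Real.ofDigits (V τ)))
        ((B : ℝ) ^ m * (x - Real.ofDigits (V (typ k))))
      have e1 : (B : ℝ) ^ m * (x - Real.ofDigits (V τ)) -
          (B : ℝ) ^ m * (x - Real.ofDigits (V (typ k))) =
          (B : ℝ) ^ m * (Real.ofDigits (V (typ k)) - Real.ofDigits (V τ)) := by ring
      rw [e1] at h2
      have e2 : 2 / (B : ℝ) = 1 / B + 1 / B := by ring
      linarith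
  refine le_invExponent fun δ hδ hx => ?_
  have hδA : δ ≤ A := by
    by_contra! hlt
    refine notMem_wellApprox_of_forall hb (c := ((B : ℝ) ^ 2)⁻¹) (by positivity) hA hlt hK
      (Eventually.of_forall fun m => ?_) hx
    rw [pow_mul, ← hBr]
    exact hmain m
  exact one_div_le_one_div_of_le (by linarith) hδA

/-- At the start `s k` of a window of type `τ` the expansions agree for at least `(ρ - 1) s k`
further digits, an approximation of exponent `ρ`. -/
lemma invExponent_le_of_windows (hb : 2 ≤ b) (hK : 0 < K) (hB : B = b ^ K)
    (hwin : ∀ k m, s k ≤ m → m < S k → D m = V (typ k) m)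
    (hs : StrictMono s) (hsS : ∀ k, s k ≤ S k)
    {τ : Bool} {ρ : ℝ} (hρ : 1 ≤ ρ) (hfreq : ∃ᶠ k in atTop, typ k = τ ∧ ρ * s k ≤ S k) :
    invExponent b (Real.ofDigits D - Real.ofDigits (V τ)) ≤ 1 / ρ := by
  have hb0 : (0 : ℝ) < b := by positivity
  have hb1 : (1 : ℝ) ≤ b := by exact_mod_cast (by omega : 1 ≤ b)
  set x := Real.ofDigits D
  set κ := invExponent b (x - Real.ofDigits (V τ)) with hκ
  by_contra! hlt
  have hκ1 : κ ≤ 1 := invExponent_le_one _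
  have hκ0 : 0 < κ := lt_trans (by positivity) hlt
  have h1 : 1 / κ < ρ := by rw [one_div_lt hκ0 (by linarith)]; exact hlt
  have h2 : 1 ≤ 1 / κ := by rwa [le_div_iff₀ hκ0, one_mul]
  set δ := (1 / κ + ρ) / 2 with hδ
  have hδ1 : 1 / κ < δ := by rw [hδ]; linarith
  have hδρ : δ < ρ := by rw [hδ]; linarith
  refine notMem_wellApprox_of_lt (b := b) (x := x - Real.ofDigits (V τ)) (δ := δ) (by linarith)
    (by rw [← hκ, one_div_lt (by linarith) hκ0]; exact hδ1) ?_
  have htend : Tendsto (fun k => K * s k) atTop atTop :=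
    tendsto_atTop_mono (fun k => Nat.le_mul_of_pos_left _ hK) hs.tendsto_atTop
  refine mem_wellApprox_of_frequently hb hδρ (C := 1) (htend.frequently ?_)
  refine hfreq.mono fun k hk => ?_
  have hag := distInt_le_of_agree (d := D) (d' := V (typ k)) (m := s k) (S := S k)
    fun i hi1 hi2 => hwin k i hi1 hi2
  rw [hk.1] at hag
  have hBr : (B : ℝ) = (b : ℝ) ^ K := by rw [hB]; push_cast; rfl
  rw [hBr, ← pow_mul, ← pow_mul] at hag
  refine hag.trans ?_
  rw [one_mul, ← Real.rpow_natCast, ← Real.rpow_neg hb0.le]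
  refine Real.rpow_le_rpow_of_exponent_le hb1 (neg_le_neg ?_)
  push_cast [Nat.cast_sub (hsS k)]
  rw [mul_assoc]
  refine mul_le_mul_of_nonneg_left ?_ (Nat.cast_nonneg _)
  linarith [hk.2]

end Exponents

/-! ### Density of the free positions. -/

open Classical in
/-- Free positions have proportion at least `a - 1/L` when the windows are sparse. -/
lemma count_freePos_ge {s S : ℕ → ℕ} (h₁ : ∀ k, s k ≤ S k) (h₂ : ∀ k, S k < s (k + 1))
    {L : ℕ} (hL : 0 < L) (h₃ : ∀ k, L * S k ≤ s (k + 1)) {a : ℝ} (ha₁ : a ≤ 1)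
    (h₄ : ∀ k, a * S k ≤ s k + a) {m : ℕ} (hm : FreePos s S m) :
    (a - 1 / L) * m - 1 ≤ Nat.count (FreePos s S) m := by
  have hmono := window_strictMono h₁ h₂
  have hLr : (0 : ℝ) < L := by exact_mod_cast hL
  have hm0 : (0 : ℝ) ≤ m := Nat.cast_nonneg m
  set N := ((Finset.range m).filter fun i => ¬ FreePos s S i) with hN
  have hcount : Nat.count (FreePos s S) m + N.card = m := by
    rw [Nat.count_eq_card_filter_range, hN, Finset.card_filter_add_card_filter_not,
      Finset.card_range]
  have hNr : (N.card : ℝ) ≤ m / L + (1 - a) * m + 1 := by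
    by_cases h0 : m ≤ s 0
    · have : N = ∅ := by
        rw [hN, Finset.filter_eq_empty_iff]
        intro i hi hni
        refine hni fun k hk => ?_
        have := hmono.monotone (Nat.zero_le k)
        have := Finset.mem_range.1 hi
        omega
      rw [this, Finset.card_empty, Nat.cast_zero]
      have : 0 ≤ (1 - a) * m := mul_nonneg (by linarith) hm0
      positivity
    -- Let window `k` be the last one starting before `m`. It ends by `m`, as `m` is free, so it
    -- occupies at most `(1 - a) m + 1` positions; all earlier windows lie below `S (k - 1) ≤ m /
    -- L`.
    have hex : ∃ k, m ≤ s (k + 1) := ⟨m, (Nat.le_succ m).trans (hmono.id_le (m + 1))⟩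
    set k := Nat.find hex
    have hk1 : m ≤ s (k + 1) := Nat.find_spec hex
    have hk0 : s k < m := by
      rcases Nat.eq_zero_or_pos k with h | h
      · rw [h]; omega
      · have := Nat.find_min hex (Nat.sub_lt h one_pos)
        rw [show Nat.find hex - 1 + 1 = k from Nat.sub_add_cancel h] at this
        omega
    have hkS : S k ≤ m := by
      by_contra hlt
      exact hm k ⟨hk0.le, by omega⟩
    have hb1 : (S k : ℝ) - s k ≤ (1 - a) * m + 1 := by
      have e1 := h₄ k
      have e2 : (S k : ℝ) ≤ m := by exact_mod_cast hkS
      have e3 := mul_le_mul_of_nonneg_left e2 (by linarith : 0 ≤ 1 - a)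
      linarith
    rcases Nat.eq_zero_or_pos k with h | h
    · have hsub : N ⊆ Finset.Ico (s k) (S k) := by
        intro i hi
        obtain ⟨hi1, hi2⟩ := Finset.mem_filter.1 hi
        simp only [FreePos, not_forall, not_not] at hi2
        obtain ⟨j, hj1, hj2⟩ := hi2
        have hi1 := Finset.mem_range.1 hi1
        have hjk : j ≤ k := by
          by_contra hlt
          have := hmono.monotone (show k + 1 ≤ j by omega)
          omega
        obtain rfl : j = k := by omega
        exact Finset.mem_Ico.2 ⟨hj1, hj2⟩
      have hc := Finset.card_le_card hsub
      rw [Nat.card_Ico] at hc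
      have : (N.card : ℝ) ≤ S k - s k := by
        rw [← Nat.cast_sub (h₁ k)]; exact_mod_cast hc
      have : 0 ≤ (m : ℝ) / L := by positivity
      linarith
    · have hsub : N ⊆ Finset.range (S (k - 1)) ∪ Finset.Ico (s k) (S k) := by
        intro i hi
        obtain ⟨hi1, hi2⟩ := Finset.mem_filter.1 hi
        simp only [FreePos, not_forall, not_not] at hi2
        obtain ⟨j, hj1, hj2⟩ := hi2
        have hi1 := Finset.mem_range.1 hi1
        have hjk : j ≤ k := by
          by_contra hlt
          have := hmono.monotone (show k + 1 ≤ j by omega)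
          omega
        rw [Finset.mem_union, Finset.mem_range, Finset.mem_Ico]
        rcases hjk.eq_or_lt with rfl | hlt
        · exact Or.inr ⟨hj1, hj2⟩
        · left
          have hS : S j ≤ S (k - 1) := by
            rcases (Nat.le_sub_one_of_lt hlt).eq_or_lt with h | h
            · rw [h]
            · exact (window_lt h₁ h₂ h).le.trans (h₁ _)
          omega
      have hc := (Finset.card_le_card hsub).trans (Finset.card_union_le _ _)
      rw [Nat.card_Ico, Finset.card_range] at hc
      have e1 : (N.card : ℝ) ≤ S (k - 1) + (S k - s k) := by
        rw [← Nat.cast_sub (h₁ k)]; exact_mod_cast hc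
      have e2 : (S (k - 1) : ℝ) ≤ m / L := by
        rw [le_div_iff₀' hLr]
        have := h₃ (k - 1)
        rw [Nat.sub_add_cancel h] at this
        exact_mod_cast this.trans hk0.le
      linarith
  have hcr : (Nat.count (FreePos s S) m : ℝ) + N.card = m := by exact_mod_cast hcount
  have : (m : ℝ) / L = 1 / L * m := by ring
  linarith

lemma invExponent_add_int (x : ℝ) (z : ℤ) : invExponent b (x + z) = invExponent b x := by
  simp only [invExponent, wellApprox_add_int]

/-! ### Realizing all pairs of exponents. -/

/-- The orbit of `y` under multiplication by `b` stays away from the integers on arbitrarily long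
(in the multiplicative sense) windows of time. -/
def HasLongWindows (b : ℕ) (y : ℝ) : Prop :=
  ∃ c > 0, ∀ M N : ℕ, ∃ n₀ ≥ N, ∀ n, n₀ ≤ n → n ≤ M * n₀ → c ≤ distInt ((b : ℝ) ^ n * y)

lemma exists_window_sequence {y c : ℝ}
    (hw : ∀ M N : ℕ, ∃ n₀ ≥ N, ∀ n, n₀ ≤ n → n ≤ M * n₀ → c ≤ distInt ((b : ℝ) ^ n * y))
    {K : ℕ} (hK : 0 < K) (L : ℕ) {ρ : ℕ → ℝ} (hρ : ∀ k, 1 ≤ ρ k) :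
    ∃ s S : ℕ → ℕ, (∀ k, s k ≤ S k) ∧ (∀ k, S k < s (k + 1)) ∧ (∀ k, L * S k ≤ s (k + 1)) ∧
      (∀ k, ρ k * s k ≤ S k) ∧ (∀ k, (S k : ℝ) ≤ ρ k * s k + 1) ∧
      ∀ k m, s k ≤ m → m < S k → c ≤ distInt ((b : ℝ) ^ (K * m) * y) := by
  have step : ∀ k n, ∃ t : ℕ, n ≤ t ∧ ∀ m, t ≤ m → m < ⌈ρ k * t⌉₊ →
      c ≤ distInt ((b : ℝ) ^ (K * m) * y) := by
    intro k n
    -- The window starts at `n₀ / K + 1` in base `b^K`, that is at most `n₀ + K ≤ 2 n₀` in base `b`;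
    -- hence the factor `2`.
    obtain ⟨n₀, hn₀, h⟩ := hw (2 * ⌈ρ k⌉₊) (K * (n + 1))
    refine ⟨n₀ / K + 1, ?_, fun m hm1 hm2 => h _ ?_ ?_⟩
    · have : n + 1 ≤ n₀ / K := (Nat.le_div_iff_mul_le hK).2 (by linarith)
      omega
    · have e1 := Nat.div_add_mod n₀ K
      have e2 := Nat.mod_lt n₀ hK
      have e3 := Nat.mul_le_mul_left K hm1
      rw [mul_add] at e3
      omega
    · have e0 : ⌈ρ k * ((n₀ / K + 1 : ℕ) : ℝ)⌉₊ ≤ ⌈ρ k⌉₊ * (n₀ / K + 1) := by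
        refine Nat.ceil_le.2 ?_
        push_cast
        exact mul_le_mul_of_nonneg_right (Nat.le_ceil _) (by positivity)
      have e1 : m ≤ ⌈ρ k⌉₊ * (n₀ / K + 1) := by omega
      have e2 : K * (n₀ / K) ≤ n₀ := Nat.mul_div_le _ _
      have e3 : K ≤ n₀ := le_trans (Nat.le_mul_of_pos_right _ (by omega)) hn₀
      calc K * m ≤ K * (⌈ρ k⌉₊ * (n₀ / K + 1)) := Nat.mul_le_mul_left _ e1
        _ = ⌈ρ k⌉₊ * (K * (n₀ / K) + K) := by ring
        _ ≤ ⌈ρ k⌉₊ * (n₀ + n₀) := Nat.mul_le_mul_left _ (by omega)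
        _ = _ := by ring
  choose g hg1 hg2 using step
  -- Starting beyond `(L + 1) S k + 1` secures both the strict gap and the sparsity `L * S k ≤ s (k
  -- + 1)`.
  obtain ⟨s, hs0, hs⟩ : ∃ s : ℕ → ℕ, s 0 = g 0 0 ∧
      ∀ k : ℕ, s (k + 1) = g (k + 1) ((L + 1) * ⌈ρ k * ((s k : ℕ) : ℝ)⌉₊ + 1) :=
    ⟨fun k => Nat.rec (motive := fun _ => ℕ) (g 0 0)
      (fun k t => g (k + 1) ((L + 1) * ⌈ρ k * ((t : ℕ) : ℝ)⌉₊ + 1)) k, rfl, fun k => rfl⟩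
  have hge : ∀ k, (L + 1) * ⌈ρ k * (s k : ℝ)⌉₊ + 1 ≤ s (k + 1) := fun k => hs k ▸ hg1 _ _
  refine ⟨s, fun k => ⌈ρ k * (s k : ℝ)⌉₊, fun k => ?_, fun k => ?_, fun k => ?_,
    fun k => Nat.le_ceil _, fun k => ?_, fun k => ?_⟩
  · have h1 : (s k : ℝ) ≤ ρ k * s k := le_mul_of_one_le_left (Nat.cast_nonneg _) (hρ k)
    exact_mod_cast h1.trans (Nat.le_ceil _)
  · have := hge k
    rw [add_mul, one_mul] at this
    dsimp only; omega
  · have := hge k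
    rw [add_mul, one_mul] at this
    dsimp only; omega
  · exact (Nat.ceil_lt_add_one (mul_nonneg (zero_le_one.trans (hρ k)) (Nat.cast_nonneg _))).le
  · cases k with
    | zero => dsimp only; rw [hs0]; exact hg2 0 0
    | succ k => dsimp only; rw [hs]; exact hg2 (k + 1) _

lemma frequently_bodd (τ : Bool) : ∃ᶠ k : ℕ in atTop, k.bodd = τ := by
  refine frequently_atTop.2 fun N => ?_
  cases τ
  · exact ⟨2 * N, by omega, by simp⟩
  · exact ⟨2 * N + 1, by omega, by simp⟩

/-- Even windows copy `0`, odd ones copy `y`, each with the length ratio that its exponent requires.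
The factor `1 - 1 / K` is the cost of restricting free digits to `b^(K-1)` of the `b^K` values; the
term `1 / L` is the cost of earlier windows. -/
lemma exists_subset_dimH_ge (hb : 2 ≤ b) {y c : ℝ}
    (hw : ∀ M N : ℕ, ∃ n₀ ≥ N, ∀ n, n₀ ≤ n → n ≤ M * n₀ → c ≤ distInt ((b : ℝ) ^ n * y))
    {a : Bool → ℝ} (ha₀ : ∀ τ, 0 ≤ a τ) (ha₁ : ∀ τ, a τ ≤ 1) {K L : ℕ} (hK : 5 ≤ K) (hL : 0 < L)
    (hKc : 2 / (b : ℝ) ^ K ≤ c) :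
    ∃ E : Set ℝ, E.Nonempty ∧
      E ⊆ {x | invExponent b x = a false ∧ invExponent b (x - y) = a true} ∧
      ∀ q, q = min (a false) (a true) - 1 / L → 0 < q →
        ENNReal.ofReal ((1 - 1 / K) * q) ≤ dimH E := by
  have hb0 : (0 : ℝ) < b := by positivity
  have hb1 : (1 : ℝ) ≤ b := by exact_mod_cast (by omega : 1 ≤ b)
  have hK0 : 0 < K := by omega
  obtain ⟨B, hB⟩ : ∃ B, B = b ^ K := ⟨_, rfl⟩
  have hBr : (B : ℝ) = (b : ℝ) ^ K := by rw [hB]; push_cast; rfl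
  set G := b ^ (K - 1) with hG
  have hGB : G + 10 ≤ B := by
    have h1 : B = G * b := by rw [hB, hG, ← pow_succ, Nat.sub_add_cancel (by omega)]
    have h2 : 2 ^ 4 ≤ G := (Nat.pow_le_pow_right two_pos (by omega : 4 ≤ K - 1)).trans
      (Nat.pow_le_pow_left hb _)
    have h3 : G * 2 ≤ G * b := Nat.mul_le_mul_left _ hb
    omega
  have hG2 : 2 ≤ G := hb.trans (Nat.le_self_pow (by omega) b)
  have : NeZero B := ⟨by omega⟩
  -- Exponent `0` requires ratios tending to infinity.
  set ρ : ℕ → ℝ := fun k => if a k.bodd = 0 then (k : ℝ) + 1 else 1 / a k.bodd with hρ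
  have hapos : ∀ {τ}, a τ ≠ 0 → 0 < a τ := fun h => lt_of_le_of_ne (ha₀ _) (Ne.symm h)
  have hρ1 : ∀ k, 1 ≤ ρ k := fun k => by
    simp only [hρ]
    split_ifs with h
    · linarith [(Nat.cast_nonneg k : (0 : ℝ) ≤ k)]
    · rw [le_div_iff₀ (hapos h), one_mul]; exact ha₁ _
  obtain ⟨s, S, h₁, h₂, h₃, h₄, h₅, h₆⟩ := exists_window_sequence hw hK0 L hρ1
  set V : Bool → ℕ → Fin B := fun τ => bif τ then Real.digits (Int.fract y) B else fun _ => 0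
    with hV
  have hVt : Real.ofDigits (V true) = Int.fract y :=
    Real.ofDigits_digits (by omega) ⟨Int.fract_nonneg y, Int.fract_lt_one y⟩
  have hVf : Real.ofDigits (V false) = 0 := by
    simp [hV, Real.ofDigits, Real.ofDigitsTerm]
  have hemb := fun m => exists_farDigits_embedding hGB (V false m) (V true m)
  choose e he1 he2 using hemb
  set D := mixDigits (FreePos s S) e (windowDigits V s S Nat.bodd) with hD
  have hfar : ∀ ω m, FreePos s S m → ∀ τ, FarDigits (D ω m) (V τ m) := fun ω m hm τ => by
    simp only [hD, mixDigits, if_pos hm]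
    cases τ
    · exact (he2 m _).1
    · exact (he2 m _).2
  have hwin : ∀ ω k m, s k ≤ m → m < S k → D ω m = V k.bodd m := fun ω k m h1 h2 => by
    have hn : ¬ FreePos s S m := fun h => h k ⟨h1, h2⟩
    simp only [hD, mixDigits, if_neg hn]
    exact windowDigits_eq V Nat.bodd h₁ h₂ ⟨h1, h2⟩
  have hfree := freePos_right_end h₁ h₂
  have hVV : ∀ k m, s k ≤ m → m < S k → 2 / (B : ℝ) ≤
      distInt ((B : ℝ) ^ m * (Real.ofDigits (V true) - Real.ofDigits (V false))) := by
    intro k m h1 h2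
    have h3 := h₆ k m h1 h2
    rw [hVt, hVf, sub_zero, Int.fract, mul_sub, hBr, ← pow_mul]
    have : (b : ℝ) ^ (K * m) * (⌊y⌋ : ℝ) = ((b ^ (K * m) * ⌊y⌋ : ℤ) : ℝ) := by push_cast; rfl
    rw [this, distInt_sub_int]
    exact hKc.trans h3
  have hmono := window_strictMono h₁ h₂
  have hexp : ∀ ω τ, invExponent b (Real.ofDigits (D ω) - Real.ofDigits (V τ)) = a τ := by
    intro ω τ
    by_cases h0 : a τ = 0
    · rw [h0]
      refine le_antisymm ?_ (invExponent_nonneg _)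
      by_contra! hpos
      set κ := invExponent b (Real.ofDigits (D ω) - Real.ofDigits (V τ)) with hκ
      have hr1 : 1 ≤ 1 / κ + 1 := by
        have : 0 < 1 / κ := by positivity
        linarith
      have := invExponent_le_of_windows (V := V) (typ := Nat.bodd) (τ := τ) hb hK0 hB
        (hwin ω) hmono h₁ hr1 (((frequently_bodd τ).and_eventually
          (eventually_ge_atTop ⌈1 / κ + 1⌉₊)).mono fun k hk => ⟨hk.1, ?_⟩)
      · rw [← hκ, le_div_iff₀ (by linarith), mul_add, mul_one_div_cancel hpos.ne'] at this
        linarith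
      · refine le_trans ?_ (h₄ k)
        refine mul_le_mul_of_nonneg_right ?_ (Nat.cast_nonneg _)
        simp only [hρ, hk.1, h0, if_true]
        have : (⌈1 / κ + 1⌉₊ : ℝ) ≤ k := by exact_mod_cast hk.2
        linarith [Nat.le_ceil (1 / κ + 1)]
    · have hp := hapos h0
      have hρτ : ∀ k, k.bodd = τ → ρ k = 1 / a τ := fun k hk => by
        simp only [hρ, hk, if_neg h0]
      have hr1 : 1 ≤ 1 / a τ := by rw [le_div_iff₀ hp, one_mul]; exact ha₁ _
      refine le_antisymm ?_ ?_
      · have := invExponent_le_of_windows (V := V) (typ := Nat.bodd) (τ := τ) hb hK0 hB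
          (hwin ω) hmono h₁ hr1 ((frequently_bodd τ).mono fun k hk => ⟨hk, hρτ k hk ▸ h₄ k⟩)
        rwa [one_div_one_div] at this
      · have := le_invExponent_of_windows (V := V) (typ := Nat.bodd) (τ := τ) hb hK0 hB
          (hfar ω) (hwin ω) hfree hVV hr1 (fun k hk => hρτ k hk ▸ h₅ k)
        rwa [one_div_one_div] at this
  refine ⟨Set.range fun ω => Real.ofDigits (D ω), ⟨_, fun _ => ⟨0, by omega⟩, rfl⟩, ?_, ?_⟩
  · rintro _ ⟨ω, rfl⟩
    refine ⟨?_, ?_⟩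
    · rw [← hexp ω false, hVf, sub_zero]
    · rw [← hexp ω true, hVt, ← invExponent_add_int _ ⌊y⌋]
      congr 1
      rw [Int.fract]; ring
  · intro q hq hq0
    set a₀ := min (a false) (a true) with ha₀'
    have hLr : (0 : ℝ) < 1 / L := by positivity
    have ha₀pos : 0 < a₀ := by linarith
    have ha₀le : ∀ τ, a₀ ≤ a τ := fun τ => by
      cases τ
      · exact min_le_left _ _
      · exact min_le_right _ _
    have hKr : (1 : ℝ) < K := by exact_mod_cast (by omega : 1 < K)
    have hinf : {m | FreePos s S m}.Infinite := by
      refine Set.infinite_of_injective_forall_mem (f := S) ?_ hfree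
      exact (strictMono_nat_of_lt_succ fun k => (h₂ k).trans_le (h₁ _)).injective
    -- The constant absorbs the `- 1` in the count of free positions and the `+ 2` in the separation
    -- bound.
    refine dimH_range_mixDigits (C := (b : ℝ) ^ (((K : ℝ) - 1) * (1 + 2 * q))) (by omega) hG2 hinf
      he1 (fun m g => ?_) (mul_pos (by
        rw [sub_pos, div_lt_one (by linarith)]; exact hKr) hq0) (by positivity) fun m hm => ?_
    · have := (he2 m g).1.1
      simp [hV] at this
      omega
    · classical
      have hcnt := count_freePos_ge h₁ h₂ hL h₃ ((ha₀le true).trans (ha₁ _)) (fun k => by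
        have e1 := h₅ k
        have hne : a k.bodd ≠ 0 := (ha₀pos.trans_le (ha₀le _)).ne'
        have e2 : a₀ * ρ k ≤ 1 := by
          simp only [hρ, if_neg hne]
          rw [mul_one_div, div_le_one (hapos hne)]
          exact ha₀le _
        have e3 := mul_le_mul_of_nonneg_left e1 ha₀pos.le
        have e4 := mul_le_mul_of_nonneg_right e2 (Nat.cast_nonneg (α := ℝ) (s k))
        linarith) hm
      rw [← hq] at hcnt
      have e1 : (((G : ℝ) ^ Nat.count (FreePos s S) m)⁻¹ : ℝ) =
          (b : ℝ) ^ (-(((K : ℝ) - 1) * Nat.count (FreePos s S) m)) := by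
        rw [hG, Nat.cast_pow, ← pow_mul, ← Real.rpow_natCast, ← Real.rpow_neg hb0.le]
        congr 2
        push_cast [Nat.cast_sub (by omega : 1 ≤ K)]
        rfl
      have e2 : ((((B : ℝ) ^ (m + 2))⁻¹) ^ ((1 - 1 / (K : ℝ)) * q) : ℝ) =
          (b : ℝ) ^ (-(((K : ℝ) - 1) * q * (m + 2))) := by
        rw [hBr, ← pow_mul, ← Real.rpow_natCast, ← Real.rpow_neg hb0.le, ← Real.rpow_mul hb0.le]
        congr 1
        push_cast
        field_simp
      rw [e1, e2, ← Real.rpow_add hb0]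
      refine Real.rpow_le_rpow_of_exponent_le hb1 ?_
      have := mul_le_mul_of_nonneg_left hcnt (by linarith : 0 ≤ (K : ℝ) - 1)
      linarith

/-- When `y` has long windows, all pairs of exponents occur, with the largest possible dimension. -/
theorem dimH_invExponent_pair (hb : 2 ≤ b) {y : ℝ} (hy : HasLongWindows b y) {a₁ a₂ : ℝ}
    (h₁ : a₁ ∈ Set.Icc (0 : ℝ) 1) (h₂ : a₂ ∈ Set.Icc (0 : ℝ) 1) :
    {x | invExponent b x = a₁ ∧ invExponent b (x - y) = a₂}.Nonempty ∧
      dimH {x | invExponent b x = a₁ ∧ invExponent b (x - y) = a₂} =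
        ENNReal.ofReal (min a₁ a₂) := by
  obtain ⟨c, hc, hw⟩ := hy
  have hb1 : (1 : ℝ) < b := by exact_mod_cast (by omega : 1 < b)
  set a : Bool → ℝ := fun τ => bif τ then a₂ else a₁ with ha
  have ha₀ : ∀ τ, 0 ≤ a τ := fun τ => by cases τ; exacts [h₁.1, h₂.1]
  have ha₁ : ∀ τ, a τ ≤ 1 := fun τ => by cases τ; exacts [h₁.2, h₂.2]
  have hev : ∀ᶠ K : ℕ in atTop, 2 / (b : ℝ) ^ K ≤ c := by
    have h := (tendsto_const_nhds (x := (2 : ℝ))).div_atTop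
      (tendsto_pow_atTop_atTop_of_one_lt hb1)
    exact (h.eventually_lt_const hc).mono fun _ h => h.le
  set Z := {x | invExponent b x = a₁ ∧ invExponent b (x - y) = a₂} with hZ
  refine ⟨?_, le_antisymm ?_ ?_⟩
  · obtain ⟨K, hK1, hK2⟩ := (hev.and (eventually_ge_atTop 5)).exists
    obtain ⟨E, ⟨x, hx⟩, hE, -⟩ := exists_subset_dimH_ge hb hw ha₀ ha₁ hK2 one_pos hK1
    exact ⟨x, hE hx⟩
  · rcases le_total a₁ a₂ with h | h
    · rw [min_eq_left h]
      exact (dimH_mono fun x hx => hx.1.le).trans (dimH_invExponent_le hb h₁.1 h₁.2)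
    · rw [min_eq_right h]
      have hsub : Z ⊆ (IsometryEquiv.addRight y) '' {x | invExponent b x ≤ a₂} := fun x hx =>
        ⟨x - y, hx.2.le, by simp⟩
      refine (dimH_mono hsub).trans ?_
      rw [IsometryEquiv.dimH_image]
      exact dimH_invExponent_le hb h₂.1 h₂.2
  · rcases (le_min h₁.1 h₂.1).eq_or_lt with h0 | h0
    · rw [← h0]; simp
    have hinv : Tendsto (fun n : ℕ => 1 / (n : ℝ)) atTop (𝓝 0) :=
      tendsto_one_div_atTop_nhds_zero_nat
    -- Both losses vanish along `K = L = n`.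
    have hlim : Tendsto (fun n : ℕ => (1 - 1 / (n : ℝ)) * (min a₁ a₂ - 1 / n)) atTop
        (𝓝 (min a₁ a₂)) := by
      have := (hinv.const_sub 1).mul (hinv.const_sub (min a₁ a₂))
      simpa using this
    refine le_of_tendsto (ENNReal.tendsto_ofReal hlim) ?_
    filter_upwards [hev, eventually_ge_atTop 5, hinv.eventually_lt_const h0] with n hn1 hn2 hn3
    obtain ⟨E, -, hE, hd⟩ := exists_subset_dimH_ge hb hw ha₀ ha₁ hn2 (by omega : 0 < n) hn1
    exact (hd _ rfl (sub_pos.2 hn3)).trans (dimH_mono hE)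

/-! ### The digits of `y`. -/

lemma inv_pow_le_ofDigits {d : ℕ → Fin b} {j k : ℕ} (hjk : j < k) (hd : (d j : ℕ) ≠ 0) :
    ((b : ℝ) ^ k)⁻¹ ≤ Real.ofDigits d := by
  have hb1 : (1 : ℝ) ≤ b := by exact_mod_cast (Fin.pos (d 0))
  have hb0 : (0 : ℝ) < b := by linarith
  refine le_trans ?_ (Real.summable_ofDigitsTerm.le_tsum j fun i _ => Real.ofDigitsTerm_nonneg)
  have h1 : (1 : ℝ) ≤ (d j : ℕ) := by exact_mod_cast Nat.one_le_iff_ne_zero.2 hd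
  calc ((b : ℝ) ^ k)⁻¹ ≤ ((b : ℝ) ^ (j + 1))⁻¹ :=
        inv_anti₀ (by positivity) (pow_le_pow_right₀ hb1 hjk)
    _ ≤ _ := le_mul_of_one_le_left (by positivity) h1

lemma ofDigits_rev (hb : 1 < b) (d : ℕ → Fin b) :
    Real.ofDigits d + Real.ofDigits (fun i => (d i).rev) = 1 := by
  rw [← Real.ofDigits_const_last_eq_one' hb, Real.ofDigits, Real.ofDigits, Real.ofDigits,
    ← Real.summable_ofDigitsTerm.tsum_add Real.summable_ofDigitsTerm]
  refine tsum_congr fun i => ?_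
  rw [Real.ofDigitsTerm, Real.ofDigitsTerm, Real.ofDigitsTerm, ← add_mul]
  congr 1
  rw [Fin.val_rev]
  have := (d i).isLt
  norm_cast
  change (d i : ℕ) + (b - (d i + 1)) = b - 1
  omega

/-- An early digit `1` keeps the number away from `0`; an early digit `0` has nonzero complement `b
- 1`, which keeps it away from `1`. -/
lemma inv_pow_le_distInt_ofDigits (hb : 2 ≤ b) {d : ℕ → Fin b} {i j k : ℕ} (hi : i < k) (hj : j < k)
    (hdi : (d i : ℕ) = 1) (hdj : (d j : ℕ) = 0) :
    ((b : ℝ) ^ k)⁻¹ ≤ distInt (Real.ofDigits d) := by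
  refine le_distInt_of_mem (inv_pow_le_ofDigits hi (by omega)) ?_
  have := inv_pow_le_ofDigits (d := fun i => (d i).rev) hj (by rw [Fin.val_rev]; omega)
  linarith [ofDigits_rev (by omega) d]

/-- Both letters `0` and `1` occurring soon after position `n` keep `b^n y` off the integers. -/
lemma inv_pow_le_distInt_of_digits (hb : 2 ≤ b) {θ : ℕ → Fin b} {n k : ℕ}
    (h₁ : ∃ i < k, (θ (n + i) : ℕ) = 1) (h₀ : ∃ j < k, (θ (n + j) : ℕ) = 0) :
    ((b : ℝ) ^ k)⁻¹ ≤ distInt ((b : ℝ) ^ n * Real.ofDigits θ) := by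
  obtain ⟨i, hi, hi'⟩ := h₁
  obtain ⟨j, hj, hj'⟩ := h₀
  rw [distInt_pow_mul_ofDigits]
  exact inv_pow_le_distInt_ofDigits hb hi hj (by rw [add_comm]; exact hi')
    (by rw [add_comm]; exact hj')

lemma distInt_le_of_zeros (hb : 2 ≤ b) {θ : ℕ → Fin b} {n m : ℕ}
    (h : ∀ i, n ≤ i → i < m → (θ i : ℕ) = 0) :
    distInt ((b : ℝ) ^ n * Real.ofDigits θ) ≤ ((b : ℝ) ^ (m - n))⁻¹ := by
  have : NeZero b := ⟨by omega⟩
  have h0 : Real.ofDigits (fun _ : ℕ => (0 : Fin b)) = 0 := by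
    simp [Real.ofDigits, Real.ofDigitsTerm]
  have := distInt_le_of_agree (d := θ) (d' := fun _ => 0) (m := n) (S := m)
    fun i h1 h2 => Fin.ext (by simpa using h i h1 h2)
  rwa [h0, sub_zero] at this

lemma getElem?_flatten_replicate {k j : ℕ} (hj : j < 2 * k) :
    ((List.replicate k [0, 1]).flatten)[j]? = some (j % 2) := by
  induction k generalizing j with
  | zero => omega
  | succ k ih =>
    rw [List.replicate_succ, List.flatten_cons]
    match j with
    | 0 => rfl
    | 1 => rfl
    | j + 2 =>
      rw [List.getElem?_append_right (by simp)]
      simp only [List.length_cons, List.length_nil, Nat.add_sub_cancel]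
      rw [ih (by omega)]
      congr 1; omega

lemma length_flatten_replicate (k : ℕ) :
    ((List.replicate k [0, 1]).flatten).length = 2 * k := by
  simp [mul_comm]

section Filler

variable {η : ℝ} {p q : ℕ}

lemma length_fillerWord : (fillerWord η p q).length =
    (⌊(p : ℝ) * η⌋₊ - p) + 1 + (q - ⌊(p : ℝ) * η⌋₊ - 1) := by
  unfold fillerWord
  rw [List.length_append, List.length_append, List.length_append, length_flatten_replicate,
    List.length_replicate]
  split_ifs with h
  · obtain ⟨k, hk⟩ := h
    simp only [List.length_cons, List.length_nil]; omega
  · obtain ⟨k, hk⟩ := Nat.not_even_iff_odd.1 h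
    simp only [List.length_cons, List.length_nil]; omega

lemma fillerWord_zeros {j : ℕ} (hj : j < ⌊(p : ℝ) * η⌋₊ - p) : (fillerWord η p q)[j]? = some 0 := by
  unfold fillerWord
  rw [List.append_assoc, List.append_assoc, List.getElem?_append_left (by simpa using hj)]
  simp [hj]

/-- The letters alternate `1010...`, except that the last one is always `1`, either by parity or
because it was appended. -/
lemma fillerWord_tail {k : ℕ} (hk : k ≤ q - ⌊(p : ℝ) * η⌋₊ - 1) :
    (fillerWord η p q)[⌊(p : ℝ) * η⌋₊ - p + k]? =
      some (if Even k ∨ k = q - ⌊(p : ℝ) * η⌋₊ - 1 then 1 else 0) := by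
  unfold fillerWord
  set N := q - ⌊(p : ℝ) * η⌋₊ - 1
  set m := ⌊(p : ℝ) * η⌋₊ - p
  rw [List.append_assoc, List.append_assoc, List.getElem?_append_right (by simp),
    List.length_replicate, Nat.add_sub_cancel_left]
  match k with
  | 0 => simp
  | k + 1 =>
    rw [List.getElem?_append_right (by simp)]
    simp only [List.length_cons, List.length_nil, zero_add, Nat.add_sub_cancel]
    rcases lt_or_ge k (2 * (N / 2)) with h | h
    · rw [List.getElem?_append_left (by rwa [length_flatten_replicate]),
        getElem?_flatten_replicate h]
      congr 1
      split_ifs with h'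
      · rcases h' with h' | h'
        · rw [Nat.even_add_one, Nat.not_even_iff] at h'; exact h'
        · omega
      · push Not at h'
        have := h'.1
        rw [Nat.not_even_iff] at this
        omega
    · have hodd : ¬ Even N := by
        intro he
        obtain ⟨r, hr⟩ := he
        omega
      rw [List.getElem?_append_right (by rwa [length_flatten_replicate]),
        length_flatten_replicate, if_neg hodd]
      rw [Nat.not_even_iff] at hodd
      have hkN : k + 1 = N := by omega
      rw [if_pos (Or.inr hkN), show k - 2 * (N / 2) = 0 by omega]
      rfl

end Filler

lemma IsConcatenation.eq_of_getElem? {ν : ℕ → List ℕ} {θ : ℕ → ℕ} (h : IsConcatenation ν θ)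
    {i j v : ℕ} (hv : (ν i)[j]? = some v) :
    θ ((∑ m ∈ Finset.range i, (ν m).length) + j) = v := by
  obtain ⟨hj, hv'⟩ := List.getElem?_eq_some_iff.1 hv
  rw [h i ⟨j, hj⟩]
  exact hv'

/-- The block structure of the digits of `y`: from position `T i` on there are zeros up to `Z i`,
and then `b^n y` stays off the integers up to position `T (i + 1)`. -/
lemma exists_block_structure (hb : 2 ≤ b) {η : ℝ} (hη : 1 < η) {l : ℕ → ℕ} (hl : StrictMono l)
    (hlim : Tendsto (fun i : ℕ => (l i : ℝ) / (l (i + 1) : ℝ)) atTop (𝓝 0))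
    {θ : ℕ → Fin b}
    (hθ : IsConcatenation (fun i => fillerWord η (l i) (l (i + 1))) (fun n => (θ n : ℕ))) :
    ∃ (i₀ : ℕ) (c : ℝ) (T Z : ℕ → ℕ), StrictMono T ∧ ∀ i ≥ i₀,
      ((T i : ℝ) = l i + c ∧ T i ≤ Z i ∧ Z i < T (i + 1) ∧ (Z i : ℝ) - T i ≤ (η - 1) * l i ∧
        (η - 1) * l i - 1 ≤ Z i - T i) ∧
      (∀ n, T i ≤ n → n < Z i → (θ n : ℕ) = 0) ∧
      ∀ n, Z i ≤ n → n < T (i + 1) →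
        ((b : ℝ) ^ 4)⁻¹ ≤ distInt ((b : ℝ) ^ n * Real.ofDigits θ) := by
  set F : ℕ → ℕ := fun i => ⌊(l i : ℝ) * η⌋₊ with hF
  set T : ℕ → ℕ := fun i => ∑ m ∈ Finset.range i, (fillerWord η (l m) (l (m + 1))).length with hT
  have hTsucc : ∀ i, T (i + 1) = T i + ((F i - l i) + 1 + (l (i + 1) - F i - 1)) := fun i => by
    simp only [hT, Finset.sum_range_succ, length_fillerWord, hF]
  have hFl : ∀ i, l i ≤ F i := fun i =>
    Nat.le_floor (le_mul_of_one_le_right (Nat.cast_nonneg _) hη.le)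
  have hpos : ∀ i, (0 : ℝ) < l (i + 1) := fun i => by
    exact_mod_cast (Nat.zero_le _).trans_lt (hl (Nat.lt_succ_self i))
  have hltop : Tendsto (fun i => (l i : ℝ)) atTop atTop :=
    tendsto_natCast_atTop_atTop.comp hl.tendsto_atTop
  have hev : ∀ᶠ i in atTop, F i < l (i + 1) ∧ l i < F i := by
    filter_upwards [hlim.eventually_lt_const (show (0 : ℝ) < 1 / η by positivity),
      hltop.eventually_ge_atTop (1 / (η - 1))] with i h1 h2
    constructor
    · rw [div_lt_div_iff₀ (hpos i) (by linarith), one_mul] at h1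
      exact (Nat.floor_lt (by positivity)).2 h1
    · rw [div_le_iff₀ (by linarith)] at h2
      refine Nat.lt_of_succ_le (Nat.le_floor ?_)
      push_cast; linarith
  obtain ⟨i₀, hi₀⟩ := eventually_atTop.1 hev
  have hTmono : StrictMono T := strictMono_nat_of_lt_succ fun i => by rw [hTsucc]; omega
  -- Finitely many initial words may have irregular length through truncated subtraction, so block
  -- starts agree with `l` only up to a constant.
  have hTl : ∀ i ≥ i₀, (T i : ℝ) = l i + ((T i₀ : ℝ) - l i₀) := by
    intro i hi
    induction i, hi using Nat.le_induction with
    | base => ring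
    | succ i hi ih =>
      have h1 := hi₀ i hi
      have h2 : T (i + 1) + l i = T i + l (i + 1) := by rw [hTsucc]; omega
      have h3 : (T (i + 1) : ℝ) + l i = T i + l (i + 1) := by exact_mod_cast h2
      linarith
  have hzero : ∀ i n, T i ≤ n → n < T i + (F i - l i) → (θ n : ℕ) = 0 := by
    intro i n h1 h2
    have := hθ.eq_of_getElem? (i := i) (fillerWord_zeros (q := l (i + 1)) (j := n - T i)
      (show n - T i < F i - l i by omega))
    change (θ (T i + (n - T i)) : ℕ) = 0 at this
    rwa [Nat.add_sub_cancel' h1] at this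
  have htail : ∀ i k, k ≤ l (i + 1) - F i - 1 → (θ (T i + (F i - l i) + k) : ℕ) =
      if Even k ∨ k = l (i + 1) - F i - 1 then 1 else 0 := by
    intro i k hk
    have := hθ.eq_of_getElem? (i := i) (fillerWord_tail (η := η) (p := l i) hk)
    change (θ (T i + (F i - l i + k)) : ℕ) = _ at this
    rwa [← add_assoc] at this
  refine ⟨i₀, (T i₀ : ℝ) - l i₀, T, fun i => T i + (F i - l i), hTmono, fun i hi =>
    ⟨⟨hTl i hi, Nat.le_add_right _ _, by rw [hTsucc]; dsimp only; omega, ?_, ?_⟩, hzero i,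
      fun n h1 h2 => ?_⟩⟩
  · push_cast [Nat.cast_sub (hFl i)]
    have := Nat.floor_le (show 0 ≤ (l i : ℝ) * η by positivity)
    simp only [hF]; linarith
  · push_cast [Nat.cast_sub (hFl i)]
    have := Nat.lt_floor_add_one ((l i : ℝ) * η)
    simp only [hF]; linarith
  · obtain ⟨k, rfl⟩ := Nat.exists_eq_add_of_le h1
    obtain ⟨hFi, -⟩ := hi₀ i hi
    obtain ⟨-, hFi'⟩ := hi₀ (i + 1) (by omega)
    set N := l (i + 1) - F i - 1 with hN
    have hTs : T (i + 1) = T i + (F i - l i) + N + 1 := by rw [hTsucc]; omega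
    have hkN : k ≤ N := by
      change T i + (F i - l i) + k < T (i + 1) at h2
      omega
    change ((b : ℝ) ^ 4)⁻¹ ≤ distInt ((b : ℝ) ^ (T i + (F i - l i) + k) * _)
    have hnext : (θ (T (i + 1)) : ℕ) = 0 := hzero (i + 1) _ le_rfl (by omega)
    -- Both letters occur among the next three; near the end of the block the `0` may be the first
    -- letter of the next one.
    refine inv_pow_le_distInt_of_digits hb ?_ ?_
    · by_cases h : Even k ∨ k = N
      · exact ⟨0, by norm_num, by rw [add_zero, htail i k hkN, if_pos h]⟩
      · push Not at h
        refine ⟨1, by norm_num, ?_⟩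
        rw [add_assoc, htail i (k + 1) (by omega), if_pos (Or.inl ?_)]
        rw [Nat.even_add_one]; exact h.1
    · rcases hkN.eq_or_lt with h | h
      · exact ⟨1, by norm_num, by rw [← hnext, hTs, h]⟩
      by_cases he : Even k
      · rcases (Nat.succ_le_of_lt h).eq_or_lt with h' | h'
        · refine ⟨2, by norm_num, ?_⟩
          rw [← hnext, hTs, ← h']; rfl
        · refine ⟨1, by norm_num, ?_⟩
          rw [add_assoc, htail i (k + 1) (by omega), if_neg]
          rw [Nat.even_add_one]
          push Not
          exact ⟨he, by omega⟩
      · refine ⟨0, by norm_num, ?_⟩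
        rw [add_zero, htail i k hkN, if_neg]
        push Not
        exact ⟨by simpa using he, by omega⟩

section Exponent

variable {η : ℝ} {l : ℕ → ℕ} {θ : ℕ → Fin b}

/-- The alternating block runs from about `η l_i` to about `l_(i+1)`, and the ratio of its ends
tends to infinity. -/
lemma hasLongWindows_of_concatenation (hb : 2 ≤ b) (hη : 1 < η) (hl : StrictMono l)
    (hlim : Tendsto (fun i : ℕ => (l i : ℝ) / (l (i + 1) : ℝ)) atTop (𝓝 0))
    (hθ : IsConcatenation (fun i => fillerWord η (l i) (l (i + 1))) (fun n => (θ n : ℕ))) :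
    HasLongWindows b (Real.ofDigits θ) := by
  obtain ⟨i₀, c, T, Z, hTmono, h⟩ := exists_block_structure hb hη hl hlim hθ
  refine ⟨((b : ℝ) ^ 4)⁻¹, by positivity, fun M N => ?_⟩
  have hpos : ∀ i, (0 : ℝ) < l (i + 1) := fun i => by
    exact_mod_cast (Nat.zero_le _).trans_lt (hl (Nat.lt_succ_self i))
  have hltop : Tendsto (fun i => (l i : ℝ)) atTop atTop :=
    tendsto_natCast_atTop_atTop.comp hl.tendsto_atTop
  have hMη : 0 < (M : ℝ) * η + 1 := by positivity
  obtain ⟨i, h1, h2, h3, h4⟩ := ((hlim.eventually_lt_const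
    (show (0 : ℝ) < 1 / (M * η + 1) by positivity)).and
    ((hltop.eventually_ge_atTop ((M + 1) * |c|)).and
      ((eventually_ge_atTop i₀).and (eventually_ge_atTop N)))).exists
  obtain ⟨⟨hT, hTZ, -, hZ1, -⟩, -, hwin⟩ := h i h3
  obtain ⟨⟨hT', -⟩, -⟩ := h (i + 1) (by omega)
  refine ⟨Z i, (h4.trans (hTmono.id_le i)).trans hTZ, fun n hn1 hn2 => hwin n hn1 ?_⟩
  rw [div_lt_div_iff₀ (hpos i) hMη, one_mul] at h1
  have e1 : (Z i : ℝ) ≤ η * l i + |c| := by linarith [le_abs_self c]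
  have e2 := mul_le_mul_of_nonneg_left e1 (Nat.cast_nonneg (α := ℝ) M)
  have e3 : (M : ℝ) * Z i < T (i + 1) := by
    rw [hT']
    linarith [neg_abs_le c]
  have e4 : M * Z i < T (i + 1) := by exact_mod_cast e3
  omega

/-- The zero run starting at `T i` has length about `(η - 1) T i`, giving every exponent below `η`.
Conversely, from a position `n` inside the run its end is at most `(η - 1) n` plus a constant away,
and outside the runs the orbit stays off the integers. -/
lemma bAdicExponent_of_concatenation (hb : 2 ≤ b) (hη : 1 < η) (hl : StrictMono l)
    (hlim : Tendsto (fun i : ℕ => (l i : ℝ) / (l (i + 1) : ℝ)) atTop (𝓝 0))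
    (hθ : IsConcatenation (fun i => fillerWord η (l i) (l (i + 1))) (fun n => (θ n : ℕ))) :
    bAdicExponent b (Real.ofDigits θ) = (η : EReal) := by
  have hb0 : (0 : ℝ) < b := by positivity
  have hb1 : (1 : ℝ) ≤ b := by exact_mod_cast (by omega : 1 ≤ b)
  obtain ⟨i₀, c, T, Z, hTmono, h⟩ := exists_block_structure hb hη hl hlim hθ
  refine bAdicExponent_eq_of_wellApprox hη (fun δ hδ => ?_) (fun δ hδ => ?_)
  · refine mem_wellApprox_of_frequently hb hδ (C := (b : ℝ) ^ ((η - 1) * c + 1))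
      (hTmono.tendsto_atTop.frequently (Eventually.frequently ?_))
    filter_upwards [eventually_ge_atTop i₀] with i hi
    obtain ⟨⟨hT, hTZ, -, -, hZ2⟩, hzero, -⟩ := h i hi
    refine (distInt_le_of_zeros hb hzero).trans ?_
    rw [← Real.rpow_natCast, ← Real.rpow_neg hb0.le, ← Real.rpow_add hb0]
    refine Real.rpow_le_rpow_of_exponent_le hb1 ?_
    rw [Nat.cast_sub hTZ]
    rw [show (l i : ℝ) = T i - c by linarith] at hZ2
    linarith
  · refine notMem_wellApprox_of_forall hb (K := 1) (c := (b : ℝ) ^ (-(4 + (η - 1) * |c|)))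
      (Real.rpow_pos_of_pos hb0 _) hη.le hδ one_pos ?_
    filter_upwards [eventually_ge_atTop (T i₀)] with n hn
    rw [one_mul]
    have hex : ∃ i, n < T (i + 1) := ⟨n, (Nat.lt_succ_self n).trans_le (hTmono.id_le (n + 1))⟩
    set i := Nat.find hex with hidef
    have hi1 : n < T (i + 1) := Nat.find_spec hex
    have hi0 : i₀ ≤ i := by
      by_contra hlt
      have := hTmono.monotone (show i + 1 ≤ i₀ by omega)
      omega
    have hi2 : T i ≤ n := by
      rcases Nat.eq_zero_or_pos i with h0 | h0
      · rw [show i = i₀ by omega]; exact hn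
      · have := Nat.find_min hex (Nat.sub_lt h0 one_pos)
        rw [show Nat.find hex - 1 + 1 = i from Nat.sub_add_cancel h0] at this
        omega
    obtain ⟨⟨hT, hTZ, hZT, hZ1, -⟩, -, hwin⟩ := h i hi0
    have hb4 : ((b : ℝ) ^ 4)⁻¹ = (b : ℝ) ^ (-(4 : ℝ)) := by
      rw [Real.rpow_neg hb0.le]; norm_cast
    have hc0 : 0 ≤ (η - 1) * |c| := mul_nonneg (by linarith) (abs_nonneg _)
    have hn0 : 0 ≤ (n : ℝ) * (η - 1) := mul_nonneg (Nat.cast_nonneg _) (by linarith)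
    rw [← Real.rpow_add hb0]
    rcases le_or_gt (Z i) n with hZn | hZn
    · refine le_trans ?_ (hwin n hZn hi1)
      rw [hb4]
      exact Real.rpow_le_rpow_of_exponent_le hb1 (by linarith)
    · refine le_trans ?_ (le_trans (div_le_div_of_nonneg_right (hwin (Z i) le_rfl hZT)
        (by positivity)) (distInt_orbit_ge hb hZn.le _))
      rw [hb4, ← Real.rpow_natCast _ (Z i - n), ← Real.rpow_sub hb0]
      refine Real.rpow_le_rpow_of_exponent_le hb1 ?_
      rw [Nat.cast_sub hZn.le]
      have e1 : (T i : ℝ) ≤ n := by exact_mod_cast hi2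
      have e2 : (l i : ℝ) ≤ n + |c| := by linarith [neg_abs_le c]
      have e3 := mul_le_mul_of_nonneg_left e2 (by linarith : 0 ≤ η - 1)
      linarith

end Exponent

/-! ### The comparison number `y'`. -/

/-- An increasing sequence of positions whose consecutive ratios tend to `η`. -/
def sparsePos (η : ℝ) : ℕ → ℕ
  | 0 => 0
  | i + 1 => ⌈η * sparsePos η i⌉₊ + 2

section SparsePos

variable {η : ℝ}

lemma sparsePos_succ_ge (η : ℝ) (i : ℕ) : η * sparsePos η i + 2 ≤ sparsePos η (i + 1) := by
  rw [sparsePos]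
  push_cast
  linarith [Nat.le_ceil (η * sparsePos η i)]

lemma sparsePos_succ_le (hη : 1 < η) (i : ℕ) :
    (sparsePos η (i + 1) : ℝ) ≤ η * sparsePos η i + 3 := by
  rw [sparsePos]
  push_cast
  linarith [Nat.ceil_lt_add_one (show 0 ≤ η * sparsePos η i by positivity)]

lemma sparsePos_add_two_le (hη : 1 < η) (i : ℕ) : sparsePos η i + 2 ≤ sparsePos η (i + 1) := by
  have h1 := sparsePos_succ_ge η i
  have h2 : (sparsePos η i : ℝ) ≤ η * sparsePos η i :=
    le_mul_of_one_le_left (Nat.cast_nonneg _) hη.le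
  have h3 : (sparsePos η i : ℝ) + 2 ≤ sparsePos η (i + 1) := by linarith
  exact_mod_cast h3

lemma sparsePos_strictMono (hη : 1 < η) : StrictMono (sparsePos η) :=
  strictMono_nat_of_lt_succ fun i => by have := sparsePos_add_two_le hη i; omega

lemma exists_sparsePos_le_lt (hη : 1 < η) (n : ℕ) :
    ∃ i, sparsePos η i ≤ n ∧ n < sparsePos η (i + 1) := by
  have hex : ∃ i, n < sparsePos η (i + 1) :=
    ⟨n, (Nat.lt_succ_self n).trans_le ((sparsePos_strictMono hη).id_le (n + 1))⟩
  refine ⟨Nat.find hex, ?_, Nat.find_spec hex⟩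
  rcases Nat.eq_zero_or_pos (Nat.find hex) with h0 | h0
  · rw [h0, sparsePos]; exact Nat.zero_le _
  · have := Nat.find_min hex (Nat.sub_lt h0 one_pos)
    rw [show Nat.find hex - 1 + 1 = Nat.find hex from Nat.sub_add_cancel h0] at this
    omega

lemma notMem_range_sparsePos (hη : 1 < η) {i n : ℕ} (h₁ : sparsePos η i < n)
    (h₂ : n < sparsePos η (i + 1)) : n ∉ Set.range (sparsePos η) := by
  rintro ⟨j, rfl⟩
  have h3 := (sparsePos_strictMono hη).lt_iff_lt.1 h₁
  have h4 := (sparsePos_strictMono hη).lt_iff_lt.1 h₂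
  omega

open Classical in
/-- The digit sequence with letters `1` exactly at the positions `sparsePos η i`. -/
def sparseDigits (hb : 2 ≤ b) (η : ℝ) (n : ℕ) : Fin b :=
  if n ∈ Set.range (sparsePos η) then ⟨1, by omega⟩ else ⟨0, by omega⟩

/-- The number whose non-zero digits are ones at the positions `sparsePos η i`. -/
def sparseNumber (hb : 2 ≤ b) (η : ℝ) : ℝ := Real.ofDigits (sparseDigits hb η)

lemma sparseDigits_zero (hb : 2 ≤ b) (hη : 1 < η) {i n : ℕ} (h₁ : sparsePos η i < n)
    (h₂ : n < sparsePos η (i + 1)) : (sparseDigits hb η n : ℕ) = 0 := by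
  rw [sparseDigits, if_neg (notMem_range_sparsePos hη h₁ h₂)]

lemma distInt_sparseNumber_le (hb : 2 ≤ b) (hη : 1 < η) (i : ℕ) :
    distInt ((b : ℝ) ^ (sparsePos η i + 1) * sparseNumber hb η) ≤
      (b : ℝ) ^ η * (b : ℝ) ^ (-(((sparsePos η i + 1 : ℕ) : ℝ) * (η - 1))) := by
  have hb0 : (0 : ℝ) < b := by positivity
  have hb1 : (1 : ℝ) ≤ b := by exact_mod_cast (by omega : 1 ≤ b)
  refine (distInt_le_of_zeros hb (m := sparsePos η (i + 1))
    fun j h1 h2 => sparseDigits_zero hb hη h1 h2).trans ?_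
  have h := sparsePos_add_two_le hη i
  rw [← Real.rpow_natCast, ← Real.rpow_neg hb0.le, ← Real.rpow_add hb0,
    Nat.cast_sub (by omega)]
  refine Real.rpow_le_rpow_of_exponent_le hb1 ?_
  have := sparsePos_succ_ge η i
  push_cast
  linarith

/-- The next `1` is at most `(η - 1) n + 3` places away and is followed by a `0`, which costs
`b^(-2)` there; together they give the constant `b^(-5)`. -/
lemma le_distInt_sparseNumber (hb : 2 ≤ b) (hη : 1 < η) (n : ℕ) (hn : 1 ≤ n) :
    (b : ℝ) ^ (-(5 : ℝ)) * (b : ℝ) ^ (-((n : ℝ) * (η - 1))) ≤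
      distInt ((b : ℝ) ^ n * sparseNumber hb η) := by
  have hb0 : (0 : ℝ) < b := by positivity
  have hb1 : (1 : ℝ) ≤ b := by exact_mod_cast (by omega : 1 ≤ b)
  obtain ⟨i, h1, h2⟩ := exists_sparsePos_le_lt hη (n - 1)
  have h3 : n ≤ sparsePos η (i + 1) := by omega
  set m := sparsePos η (i + 1) with hm
  have h4 : ((b : ℝ) ^ 2)⁻¹ ≤ distInt ((b : ℝ) ^ m * sparseNumber hb η) := by
    refine inv_pow_le_distInt_of_digits hb ⟨0, by norm_num, ?_⟩ ⟨1, by norm_num, ?_⟩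
    · rw [add_zero, sparseDigits, if_pos ⟨i + 1, rfl⟩]
    · have := sparsePos_add_two_le hη (i + 1)
      exact sparseDigits_zero hb hη (i := i + 1) (by omega) (by omega)
  refine le_trans ?_ ((div_le_div_of_nonneg_right h4 (by positivity)).trans
    (distInt_orbit_ge hb h3 _))
  rw [← Real.rpow_add hb0, ← Real.rpow_natCast, ← Real.rpow_neg hb0.le, ← Real.rpow_natCast,
    ← Real.rpow_sub hb0, Nat.cast_sub h3]
  refine Real.rpow_le_rpow_of_exponent_le hb1 ?_
  have h5 := sparsePos_succ_le hη i
  have h6 : (sparsePos η i : ℝ) ≤ n := by exact_mod_cast (by omega : sparsePos η i ≤ n)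
  have h7 := mul_le_mul_of_nonneg_left h6 (by linarith : 0 ≤ η)
  push_cast
  linarith

lemma tendsto_sparsePos_succ (hη : 1 < η) :
    Tendsto (fun i => sparsePos η i + 1) atTop atTop :=
  tendsto_atTop_mono (fun _ => Nat.le_succ _) (sparsePos_strictMono hη).tendsto_atTop

lemma bAdicExponent_sparseNumber (hb : 2 ≤ b) (hη : 1 < η) :
    bAdicExponent b (sparseNumber hb η) = (η : EReal) := by
  have hb0 : (0 : ℝ) < b := by positivity
  refine bAdicExponent_eq_of_wellApprox hη (fun δ hδ => ?_) (fun δ hδ => ?_)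
  · exact mem_wellApprox_of_frequently hb hδ ((tendsto_sparsePos_succ hη).frequently
      (Frequently.of_forall (distInt_sparseNumber_le hb hη)))
  · refine notMem_wellApprox_of_forall hb (K := 1) (c := (b : ℝ) ^ (-(5 : ℝ)))
      (Real.rpow_pos_of_pos hb0 _) hη.le hδ one_pos ?_
    filter_upwards [eventually_ge_atTop 1] with n hn
    rw [one_mul]
    exact le_distInt_sparseNumber hb hη n hn

/-- A very well approximable `x` forces `x - sparseNumber` to be well approximable. -/
lemma invExponent_sub_sparseNumber_lt_one (hb : 2 ≤ b) (hη : 1 < η) {x : ℝ}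
    (hx : invExponent b x = 0) : invExponent b (x - sparseNumber hb η) < 1 := by
  have hb0 : (0 : ℝ) < b := by positivity
  have hb1 : (1 : ℝ) ≤ b := by exact_mod_cast (by omega : 1 ≤ b)
  -- An approximation of `x` at time `p` must last past the start `n ≤ η p + 4` of a zero run of
  -- `y'` and still have strength `n (η - 1)`. This requires `η n ≤ δ p`, and `η (η p + 4) ≤ (η² + 4
  -- η) p` for `p ≥ 1`.
  have hδ1 : 1 ≤ η ^ 2 + 4 * η := by nlinarith
  have hxW : x ∈ wellApprox b (η ^ 2 + 4 * η) :=
    mem_wellApprox_of_lt hb hδ1 (by rw [hx]; positivity)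
  have hmem : x - sparseNumber hb η ∈ wellApprox b ((1 + η) / 2) := by
    refine mem_wellApprox_of_frequently hb (ρ := η) (C := 1 + (b : ℝ) ^ η) (by linarith) ?_
    refine frequently_atTop.2 fun N => ?_
    obtain ⟨p, hpN, hp⟩ := frequently_atTop.1 hxW (N + 1)
    obtain ⟨i, h1, h2⟩ := exists_sparsePos_le_lt hη p
    set n := sparsePos η (i + 1) + 1 with hn
    have hpn : p ≤ n := by omega
    refine ⟨n, by omega, ?_⟩
    have h3 : distInt ((b : ℝ) ^ n * x) ≤ (b : ℝ) ^ (-((n : ℝ) * (η - 1))) := by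
      have h4 := distInt_orbit_ge hb hpn x
      rw [div_le_iff₀ (by positivity)] at h4
      refine h4.trans ((mul_le_mul_of_nonneg_right hp (by positivity)).trans ?_)
      rw [one_div, ← Real.rpow_neg hb0.le, ← Real.rpow_natCast _ (n - p), ← Real.rpow_add hb0,
        Nat.cast_sub hpn]
      refine Real.rpow_le_rpow_of_exponent_le hb1 ?_
      have h5 := sparsePos_succ_le hη i
      have h6 : (sparsePos η i : ℝ) ≤ p := by exact_mod_cast h1
      have h7 : (1 : ℝ) ≤ p := by exact_mod_cast (by omega : 1 ≤ p)
      have h8 : (n : ℝ) ≤ η * p + 4 := by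
        rw [hn]; push_cast
        have := mul_le_mul_of_nonneg_left h6 (by linarith : 0 ≤ η)
        linarith
      have h9 := mul_le_mul_of_nonneg_left h8 (by linarith : 0 ≤ η)
      have h10 := mul_le_mul_of_nonneg_left h7 (by linarith : 0 ≤ 4 * η)
      linarith
    rw [mul_sub]
    refine (distInt_sub_le _ _).trans ?_
    rw [add_mul, one_mul]
    exact add_le_add h3 (distInt_sparseNumber_le hb hη (i + 1))
  refine (invExponent_le (by linarith) hmem).trans_lt ?_
  rw [div_lt_one (by linarith)]
  linarith

end SparsePos

/-! ### Bivariate spectra. -/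

lemma bivariateLevelSet_levy (hb : 2 ≤ b) {α₁ α₂ : ℝ} (h₁ : 0 < α₁) (h₂ : 0 < α₂) (y H₁ H₂ : ℝ) :
    bivariateLevelSet (levy b α₁) (levyTranslate b α₂ y) H₁ H₂ =
      {x | invExponent b x = H₁ / α₁ ∧ invExponent b (x - y) = H₂ / α₂} := by
  ext x
  simp only [bivariateLevelSet, Set.mem_ofPred_eq, holderExponent_levy hb h₁,
    holderExponent_levyTranslate hb h₂, EReal.coe_eq_coe_iff, eq_div_iff h₁.ne', eq_div_iff h₂.ne',
    mul_comm]

theorem bivariateSpectrum_of_hasLongWindows (hb : 2 ≤ b) {y : ℝ} (hy : HasLongWindows b y)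
    {α₁ α₂ : ℝ} (h₁ : 0 < α₁) (h₂ : 0 < α₂) {H₁ H₂ : ℝ} (hH₁ : H₁ ∈ Set.Icc 0 α₁)
    (hH₂ : H₂ ∈ Set.Icc 0 α₂) :
    bivariateSpectrum (levy b α₁) (levyTranslate b α₂ y) H₁ H₂ =
      ((min (H₁ / α₁) (H₂ / α₂) : ℝ) : EReal) := by
  have ha₁ : H₁ / α₁ ∈ Set.Icc (0 : ℝ) 1 :=
    ⟨div_nonneg hH₁.1 h₁.le, (div_le_one h₁).2 hH₁.2⟩
  have ha₂ : H₂ / α₂ ∈ Set.Icc (0 : ℝ) 1 :=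
    ⟨div_nonneg hH₂.1 h₂.le, (div_le_one h₂).2 hH₂.2⟩
  obtain ⟨hne, hdim⟩ := dimH_invExponent_pair hb hy ha₁ ha₂
  rw [bivariateSpectrum, bivariateLevelSet_levy hb h₁ h₂, if_neg hne.ne_empty, hdim,
    EReal.coe_ennreal_ofReal, max_eq_left (le_min ha₁.1 ha₂.1)]

theorem bivariateSpectrum_eq_bot (hb : 2 ≤ b) (y : ℝ) {α₁ α₂ : ℝ} (h₁ : 0 < α₁) (h₂ : 0 < α₂)
    {H₁ H₂ : ℝ} (hH : ¬ (H₁ ∈ Set.Icc 0 α₁ ∧ H₂ ∈ Set.Icc 0 α₂)) :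
    bivariateSpectrum (levy b α₁) (levyTranslate b α₂ y) H₁ H₂ = ⊥ := by
  rw [bivariateSpectrum, bivariateLevelSet_levy hb h₁ h₂, if_pos]
  refine Set.eq_empty_of_forall_notMem fun x hx => hH ?_
  have e₁ := invExponent_nonneg (b := b) x
  have e₂ := invExponent_nonneg (b := b) (x - y)
  have e₃ := invExponent_le_one (b := b) x
  have e₄ := invExponent_le_one (b := b) (x - y)
  rw [hx.1] at e₁ e₃
  rw [hx.2] at e₂ e₄
  refine ⟨⟨?_, (div_le_one h₁).1 e₃⟩, ⟨?_, (div_le_one h₂).1 e₄⟩⟩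
  · simpa [h₁.ne'] using mul_nonneg e₁ h₁.le
  · simpa [h₂.ne'] using mul_nonneg e₂ h₂.le

theorem bivariateSpectrum_sparseNumber (hb : 2 ≤ b) {η : ℝ} (hη : 1 < η) {α₁ α₂ : ℝ}
    (h₁ : 0 < α₁) (h₂ : 0 < α₂) :
    bivariateSpectrum (levy b α₁) (levyTranslate b α₂ (sparseNumber hb η)) 0 α₂ = ⊥ := by
  rw [bivariateSpectrum, bivariateLevelSet_levy hb h₁ h₂, if_pos]
  refine Set.eq_empty_of_forall_notMem fun x hx => ?_
  have h := invExponent_sub_sparseNumber_lt_one hb hη (x := x) (by simpa using hx.1)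
  rw [hx.2, div_self h₂.ne'] at h
  exact lt_irrefl _ h

end

theorem proposition4 (b : ℕ) (hb : 2 ≤ b) (η : ℝ) (hη : 1 < η)
    (l : ℕ → ℕ) (hl : StrictMono l)
    (hlim : Tendsto (fun i : ℕ => (l i : ℝ) / (l (i + 1) : ℝ)) atTop (𝓝 0))
    (θ : ℕ → Fin b)
    (hθ : IsConcatenation (fun i => fillerWord η (l i) (l (i + 1))) (fun n => (θ n : ℕ)))
    (y : ℝ) (hy : y = Real.ofDigits θ) :
    (∀ α₁ α₂ : ℝ, 0 < α₁ → 0 < α₂ → ∀ H₁ H₂ : ℝ,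
      ((H₁ ∈ Set.Icc 0 α₁ ∧ H₂ ∈ Set.Icc 0 α₂) →
        bivariateSpectrum (levy b α₁) (levyTranslate b α₂ y) H₁ H₂
          = ((min (H₁ / α₁) (H₂ / α₂) : ℝ) : EReal)) ∧
      (¬ (H₁ ∈ Set.Icc 0 α₁ ∧ H₂ ∈ Set.Icc 0 α₂) →
        bivariateSpectrum (levy b α₁) (levyTranslate b α₂ y) H₁ H₂ = ⊥)) ∧
    bAdicExponent b y = (η : EReal) ∧
    (∃ y' : ℝ, bAdicExponent b y' = bAdicExponent b y ∧
      ∀ α₁ α₂ : ℝ, 0 < α₁ → 0 < α₂ →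
        bivariateSpectrum (levy b α₁) (levyTranslate b α₂ y')
          ≠ bivariateSpectrum (levy b α₁) (levyTranslate b α₂ y)) := by
  subst hy
  have hw := hasLongWindows_of_concatenation hb hη hl hlim hθ
  have hexp := bAdicExponent_of_concatenation hb hη hl hlim hθ
  refine ⟨fun α₁ α₂ h₁ h₂ H₁ H₂ =>
    ⟨fun hH => bivariateSpectrum_of_hasLongWindows hb hw h₁ h₂ hH.1 hH.2,
      fun hH => bivariateSpectrum_eq_bot hb _ h₁ h₂ hH⟩, hexp,
    sparseNumber hb η, by rw [hexp, bAdicExponent_sparseNumber hb hη], fun α₁ α₂ h₁ h₂ heq => ?_⟩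
  -- The spectra are compared at `(0, α₂)`: an empty level set for `y'`, a nonempty one of dimension
  -- `0` for `y`.
  have e₁ := bivariateSpectrum_sparseNumber hb hη h₁ h₂
  rw [heq, bivariateSpectrum_of_hasLongWindows hb hw h₁ h₂ ⟨le_rfl, h₁.le⟩ ⟨h₂.le, le_rfl⟩] at e₁
  exact EReal.coe_ne_bot _ e₁
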